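/- **1D Magic Square circuit.** For $n\ge 1$ let $b=(\alpha_1,\dots,\alpha_n,\beta_1,\dots,\beta_n)\in(\{0,1\}^2)^{2n}=\{0,1\}^{4n}$. Let $C^{MS}_b$ be the following Clifford unitary on $4n$ qubits $p_1,q_1,\dots,p_{2n},q_{2n}$: (1) apply Hadamard gates to $p_{2j-1},q_{2j-1}$; (2) apply CNOT gates $p_{2j-1}\to p_{2j}$ and $q_{2j-1}\to q_{2j}$; (3) apply $U(\alpha_j)$ to $(p_{2j-1},q_{2j-1})$ and $V(\beta_j)$ to $(p_{2j},q_{2j})$, for all $1\le j\le n$; (4) for $1\le j<n$ with $\beta_j=\alpha_{j+1}=00$ apply $M=(H\otimes I)\,\mathrm{CNOT}$ to $(p_{2j},p_{2j+1})$ and to $(q_{2j},q_{2j+1})$. Here $U(00)=V(00)=I$, $U(01)=H_1$, $U(10)=H_1\,\mathrm{SWAP}$, $U(11)=H_1\,\mathrm{CNOT}$, $V(01)=H_1H_2$, $V(10)=\mathrm{SWAP}$, $V(11)=H_1H_2\,\mathrm{CZ}\,Z_1Z_2$. The 1D Magic Square relation $R(b,z)$ holds iff $|\langle z|C^{MS}_b|0^{4n}\rangle|^2>0$.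 Let $S\subset\{0,1\}^{4n}$ be the set of inputs for which there are $1\le j<k\le n$ and $\alpha,\beta\in\{01,10,11\}$ with $\alpha_j=\alpha$, $\beta_k=\beta$ and all other pairs equal to $00$. **Noise-tolerant relation.** Let $U$ be a circuit of layers of $H$, $S=\mathrm{diag}(1,i)$ and CNOT gates (acting on disjoint qubits within a layer), each gate being switched on or off by at most $k$ bits of $b$, that realizes $C^{MS}_b$ up to a global phase for every $b$. Let $\mathcal Q_m$ be a CSS code that encodes one qubit into $m$ physical qubits, with $|\overline 0\rangle\propto\sum_{x\in\mathcal B}|x\rangle$, $|\overline 1\rangle\propto\sum_{x\in\mathcal B}|x\oplus\beta\rangle$, where $\mathcal B\subseteq\{0,1\}^m$ is a linear subspace and $\beta\notin\mathcal B$, and whose logical gates $H$ and $S$ are implemented (up to a global phase) by given depth-1 Clifford circuits of one- and two-qubit gates. Let $\overline C_b$ be the physical circuit obtained by encoding every qubit of $U$ into its own block of $m$ qubits and replacing every gate by its logical version (transversal for CNOT). Let $\mathsf{Rec}:\{0,1\}^{m_{\rm anc}}\to\mathrm{Pauli}(m)$ (modulo phases) and $\mathsf{Dec}:\{0,1\}^m\to\{0,1\}$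 be arbitrary functions, in particular those that belong to a single-shot state preparation procedure and a noise-robust logical measurement of $\mathcal Q_m$. For $s=(s^1,\dots,s^{4n})$ with $s^i\in\{0,1\}^{m_{\rm anc}}$ define $f=(f^1,\dots,f^{4n})\in\{0,1\}^{4nm}$ by $\overline C_b\,(\mathsf{Rec}(s^1)\otimes\cdots\otimes\mathsf{Rec}(s^{4n}))\,\overline C_b^{\dagger}\sim X(f)Z(h)$. The noise-tolerant 1D Magic Square relation $\mathcal R^{MS}_U(b,(s,y))$, with $y=(y^1,\dots,y^{4n})$, $y^i\in\{0,1\}^m$, holds iff $R(b,z)$ holds for $z_i=\mathsf{Dec}(y^i\oplus f^i)$. **Theorem.** Let $A\in\mathbb R$ and $a,D,k\in\mathbb N$. There are $\delta>0$ and $n_0$, depending only on $A,a,D,k$, such that for all $n\ge n_0$ the following holds. Let $\mathcal R^{MS}_U$ be defined as above by $U$ of depth at most $D$ with gates controlled by at most $k$ input bits, and by a code with $m,m_{\rm anc}\le A(\log n)^a$. Let $\mathcal C$ be a classical probabilistic circuit (a directed acyclic graph of arbitrary Boolean gates, some of whose inputs are random bits with an arbitrary joint distribution independent of $b$) with gates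 of fan-in at most $K\le A(\log n)^a$. If, for $b$ uniformly random in $S$, the output $(s,y)$ of $\mathcal C$ satisfies $\mathcal R^{MS}_U(b,(s,y))$ with probability greater than $9/10$ (over $b$ and the random bits), then $$\mathrm{depth}(\mathcal C)\;\ge\;\delta\,\frac{\log n}{\log\log n}.$$ -/

import Mathlib

namespace MagicSquare

/-! ## Qubits, Pauli and Clifford operators -/

/-- A bit; `Q → Bit` is the set of bit strings indexed by `Q`, and `+` is the bitwise XOR. -/
abbrev Bit := ZMod 2

/-- Operators on the Hilbert space of the qubits in `Q`, in the computational basis. -/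
abbrev Op (Q : Type) := Matrix (Q → Bit) (Q → Bit) ℂ

/-- The Pauli operator `X(f) Z(h)`, which sends `|y⟩` to `(-1)^(h·y) |y ⊕ f⟩`. -/
def pauliXZ {Q : Type} [Fintype Q] [DecidableEq Q] (f h : Q → Bit) : Op Q :=
  fun x y => if x = y + f then (-1) ^ (h ⬝ᵥ y).val else 0

/-- A unitary that conjugates Pauli operators to Pauli operators, up to phases. -/
def IsClifford {Q : Type} [Fintype Q] [DecidableEq Q] (U : Op Q) : Prop :=
  U ∈ Matrix.unitaryGroup (Q → Bit) ℂ ∧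
    ∀ f h : Q → Bit, ∃ (f' h' : Q → Bit) (c : ℂ), ‖c‖ = 1 ∧
      U * pauliXZ f h * U.conjTranspose = c • pauliXZ f' h'

open Classical in
/-- The operator that applies `G` to the qubits `w i` (`w` injective) and the identity to all
other qubits. -/
noncomputable def onWires {ι Q : Type} (w : ι → Q) (G : Op ι) : Op Q :=
  fun x y => if ∀ q, q ∉ Set.range w → x q = y q then G (x ∘ w) (y ∘ w) else 0

/-- The Hadamard gate. -/
noncomputable def gateH : Op (Fin 1) :=
  fun x y => ((Real.sqrt 2)⁻¹ : ℝ) * (-1) ^ (x 0 * y 0).val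

/-- The phase gate `diag(1, i)`. -/
noncomputable def gateS : Op (Fin 1) :=
  fun x y => if x = y then Complex.I ^ (x 0).val else 0

/-- The CNOT gate with control `0` and target `1`. -/
def gateCNOT : Op (Fin 2) :=
  fun x y => if x 0 = y 0 ∧ x 1 = y 1 + y 0 then 1 else 0

/-- The gate `|z₁ z₂⟩ ↦ |z₂ z₁⟩`. -/
def gateSWAP : Op (Fin 2) :=
  fun x y => if x 0 = y 1 ∧ x 1 = y 0 then 1 else 0

/-- The gate `diag(1, 1, 1, -1)`. -/
def gateCZ : Op (Fin 2) :=
  fun x y => if x = y then (-1) ^ (x 0 * x 1).val else 0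

/-! ## Classically controlled circuits composed of `H`, `S`, `CNOT` -/

/-- An elementary gate on the qubits `N`. -/
inductive ElemGate (N : Type)
  | h (q : N) : ElemGate N
  | s (q : N) : ElemGate N
  | cnot (c t : N) (hne : c ≠ t) : ElemGate N

/-- The set of qubits on which a gate acts. -/
def ElemGate.support {N : Type} : ElemGate N → Set N
  | .h q => {q}
  | .s q => {q}
  | .cnot c t _ => {c, t}

/-- The unitary operator of a gate. -/
noncomputable def ElemGate.op {N : Type} : ElemGate N → Op N
  | .h q => onWires ![q] gateH
  | .s q => onWires ![q] gateS
  | .cnot c t _ => onWires ![c, t] gateCNOT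

/-- A gate which is applied or not, as determined by the input bits in `ctrl`. -/
structure CtrlGate (V N : Type) where
  gate : ElemGate N
  ctrl : Finset V
  active : (ctrl → Bit) → Prop

/-- A controlled circuit: a list of layers, the first layer being applied first; the gates of a
layer act on pairwise disjoint sets of qubits. -/
structure CtrlCircuit (V N : Type) where
  layers : List (List (CtrlGate V N))
  disjoint_supports : ∀ l ∈ layers,
    l.Pairwise fun g g' => Disjoint g.gate.support g'.gate.support

/-- The number of layers. -/
def CtrlCircuit.depth {V N : Type} (U : CtrlCircuit V N) : ℕ := U.layers.length

/-- Every gate is controlled by at most `k` input bits. -/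
def CtrlCircuit.ControlledByAtMost {V N : Type} (U : CtrlCircuit V N) (k : ℕ) : Prop :=
  ∀ l ∈ U.layers, ∀ g ∈ l, g.ctrl.card ≤ k

open Classical in
/-- The operator obtained from the circuit on the input `b` when every elementary gate `g` is
executed as the operator `exec g`. -/
noncomputable def CtrlCircuit.run {V N Q : Type} [Fintype Q] [DecidableEq Q] (U : CtrlCircuit V N)
    (exec : ElemGate N → Op Q) (b : V → Bit) : Op Q :=
  U.layers.foldl
    (fun acc l =>
      (l.map fun g => if g.active (fun v => b v) then exec g.gate else 1).prod * acc) 1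

/-- The Clifford unitary `C_b` applied to the data qubits on the input `b`. -/
noncomputable def CtrlCircuit.op {V N : Type} [Fintype N] [DecidableEq N] (U : CtrlCircuit V N)
    (b : V → Bit) : Op N :=
  U.run ElemGate.op b

/-- The bare relation: `z` has non-zero probability `|⟨z| C_b |0⟩|²`. -/
def bareRelation {V N : Type} (C : (V → Bit) → Op N) (b : V → Bit) (z : N → Bit) : Prop :=
  0 < ‖C b z 0‖ ^ 2

/-! ## Codes -/

/-- A CSS-type code with one logical qubit in `m` physical qubits. The logical states are
`|0̄⟩ ∝ ∑_{x ∈ B} |x⟩` and `|1̄⟩ ∝ ∑_{x ∈ B} |x ⊕ β⟩`, the logical Pauli operators are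
`Z̄ = Z(α)` and `X̄ = X(β)`. -/
structure CSSCode (m : ℕ) where
  B : Submodule Bit (Fin m → Bit)
  β : Fin m → Bit
  α : Fin m → Bit
  β_notMem : β ∉ B
  α_dot_β : α ⬝ᵥ β = 1
  α_perp : ∀ x ∈ B, α ⬝ᵥ x = 0

open Classical in
/-- The encoding map, whose column `v` is the logical basis state `v`. -/
noncomputable def CSSCode.enc {m : ℕ} (Q : CSSCode m) :
    Matrix (Fin m → Bit) (Fin 1 → Bit) ℂ :=
  fun x v => if x + v 0 • Q.β ∈ Q.B then ((Real.sqrt (Nat.card Q.B))⁻¹ : ℝ) else 0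

/-- The physical operator `P` implements the logical gate `G`, up to a global phase. -/
def CSSCode.Implements {m : ℕ} (Q : CSSCode m) (P : Op (Fin m)) (G : Op (Fin 1)) : Prop :=
  ∃ c : ℂ, ‖c‖ = 1 ∧ P * Q.enc = c • (Q.enc * G)

/-- A one- or two-qubit Clifford gate on the qubits `P`. -/
structure CliffordGate (P : Type) where
  arity : ℕ
  arity_mem : arity = 1 ∨ arity = 2
  wires : Fin arity ↪ P
  mat : Op (Fin arity)
  clifford : IsClifford mat

/-- A depth-one Clifford circuit: one- and two-qubit Clifford gates on disjoint qubits. -/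
structure DepthOneClifford (P : Type) where
  gates : List (CliffordGate P)
  disjoint_wires : gates.Pairwise fun g g' => Disjoint (Set.range g.wires) (Set.range g'.wires)

/-- The unitary operator of a depth-one Clifford circuit. -/
noncomputable def DepthOneClifford.op {P : Type} [Fintype P] [DecidableEq P] (C : DepthOneClifford P) :
    Op P :=
  (C.gates.map fun g => onWires g.wires g.mat).prod

/-- Depth-one Clifford circuits for the logical Hadamard and phase gates of a code. -/
structure LogicalGates {m : ℕ} (Q : CSSCode m) where
  H : DepthOneClifford (Fin m)
  S : DepthOneClifford (Fin m)
  H_implements : Q.Implements H.op gateH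
  S_implements : Q.Implements S.op gateS

/-- The physical version of an elementary gate, when each qubit `q` in `N` is encoded into the
block of physical qubits `(q, i)`, `i < m`. The logical CNOT is transversal. -/
noncomputable def LogicalGates.encodedGate {m : ℕ} {Q : CSSCode m} (L : LogicalGates Q)
    {N : Type} [Fintype N] [DecidableEq N] : ElemGate N → Op (N × Fin m)
  | .h q => onWires (fun i => (q, i)) L.H.op
  | .s q => onWires (fun i => (q, i)) L.S.op
  | .cnot c t _ => ((List.finRange m).map fun i => onWires ![(c, i), (t, i)] gateCNOT).prod

/-- The encoded circuit `C̄_b`. -/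
noncomputable def LogicalGates.encodedOp {m : ℕ} {Q : CSSCode m} (L : LogicalGates Q)
    {V N : Type} [Fintype N] [DecidableEq N] (U : CtrlCircuit V N) (b : V → Bit) :
    Op (N × Fin m) :=
  U.run L.encodedGate b

/-! ## The noise-tolerant relation -/

/-- The noise-tolerant relation of the controlled Clifford circuit `U`. The recovery function has
values in the Pauli group modulo phases: `Rec s = (f, h)` stands for `X(f) Z(h)`. The string `f`
below is determined by `s` and `b`, because the operators `X(f) Z(h)` are pairwise
non-proportional. -/
def noiseTolerantRelation {V N : Type} [Fintype N] [DecidableEq N] {m mAnc : ℕ} {Q : CSSCode m}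
    (L : LogicalGates Q) (Rec : (Fin mAnc → Bit) → (Fin m → Bit) × (Fin m → Bit))
    (Dec : (Fin m → Bit) → Bit) (U : CtrlCircuit V N) (b : V → Bit)
    (s : N → Fin mAnc → Bit) (y : N → Fin m → Bit) : Prop :=
  ∃ (f h : N × Fin m → Bit) (c : ℂ), ‖c‖ = 1 ∧
    L.encodedOp U b *
        pauliXZ (fun p : N × Fin m => (Rec (s p.1)).1 p.2) (fun p => (Rec (s p.1)).2 p.2) *
        (L.encodedOp U b).conjTranspose = c • pauliXZ f h ∧
    bareRelation U.op b (fun q => Dec fun i => y q i + f (q, i))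

/-! ## The 1D Magic Square Problem -/

/-- Labels of the `4n` input bits, and of the `4n` data qubits and output bits. As input bits,
`(j, 0, ·)` is the pair `α_j` and `(j, 1, ·)` is the pair `β_j`. As data qubits, with `j` counted
from `1`, `(j, 0, 0) = p_{2j-1}`, `(j, 0, 1) = q_{2j-1}`, `(j, 1, 0) = p_{2j}` and
`(j, 1, 1) = q_{2j}`. -/
abbrev MSIndex (n : ℕ) := Fin n × Fin 2 × Fin 2

/-- Alice's gate `U(γ)`. -/
noncomputable def gateU (γ : Fin 2 → Bit) : Op (Fin 2) :=
  if γ = ![0, 1] then onWires ![0] gateH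
  else if γ = ![1, 0] then onWires ![0] gateH * gateSWAP
  else if γ = ![1, 1] then onWires ![0] gateH * gateCNOT
  else 1

/-- Bob's gate `V(γ)`; `pauliXZ 0 1` is `Z ⊗ Z`. -/
noncomputable def gateV (γ : Fin 2 → Bit) : Op (Fin 2) :=
  if γ = ![0, 1] then onWires ![0] gateH * onWires ![1] gateH
  else if γ = ![1, 0] then gateSWAP
  else if γ = ![1, 1] then onWires ![0] gateH * onWires ![1] gateH * gateCZ * pauliXZ 0 1
  else 1

/-- The Bell basis change `M = (H ⊗ I) CNOT`. -/
noncomputable def gateM : Op (Fin 2) := onWires ![0] gateH * gateCNOT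

/-- The entanglement swapping gate `W(β, α)`. -/
noncomputable def gateW (β α : Fin 2 → Bit) : Op (Fin 4) :=
  if β = 0 ∧ α = 0 then onWires ![0, 2] gateM * onWires ![1, 3] gateM else 1

/-- The unitary of the circuit that defines the 1D Magic Square Problem, on the input `b`. -/
noncomputable def msUnitary (n : ℕ) (b : MSIndex n → Bit) : Op (MSIndex n) :=
  ((List.finRange n).map fun j =>
      if hj : j.val + 1 < n then
        onWires ![(j, 1, 0), (j, 1, 1), (⟨j.val + 1, hj⟩, 0, 0), (⟨j.val + 1, hj⟩, 0, 1)]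
          (gateW (fun i => b (j, 1, i)) (fun i => b (⟨j.val + 1, hj⟩, 0, i)))
      else 1).prod *
  ((List.finRange n).map fun j =>
      onWires ![(j, 0, 0), (j, 0, 1)] (gateU fun i => b (j, 0, i)) *
        onWires ![(j, 1, 0), (j, 1, 1)] (gateV fun i => b (j, 1, i))).prod *
  ((List.finRange n).map fun j =>
      onWires ![(j, 0, 0), (j, 1, 0)] gateCNOT * onWires ![(j, 0, 1), (j, 1, 1)] gateCNOT).prod *
  ((List.finRange n).map fun j =>
      onWires ![(j, 0, 0)] gateH * onWires ![(j, 0, 1)] gateH).prod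

/-- The controlled circuit `U` realizes the circuit of the 1D Magic Square Problem, up to global
phases. -/
def RealizesMagicSquareCircuit {n : ℕ} (U : CtrlCircuit (MSIndex n) (MSIndex n)) : Prop :=
  ∀ b : MSIndex n → Bit, ∃ c : ℂ, ‖c‖ = 1 ∧ U.op b = c • msUnitary n b

open Classical in
/-- The set `S` of inputs: `α_j = α` and `β_k = β` for some `j < k` and some non-zero `α`, `β`,
and all other pairs are `00`. -/
noncomputable def msInputs (n : ℕ) : Finset (MSIndex n → Bit) :=
  {b | ∃ (j k : Fin n) (α β : Fin 2 → Bit), j < k ∧ α ≠ 0 ∧ β ≠ 0 ∧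
    (∀ i, (fun e => b (i, 0, e)) = if i = j then α else 0) ∧
    (∀ i, (fun e => b (i, 1, e)) = if i = k then β else 0)}

/-! ## Classical circuits -/

/-- A classical circuit with input bits `I` and output bits `O`: an acyclic graph, whose gates are
numbered so that every gate reads only input bits and gates with smaller numbers. Gates compute
arbitrary Boolean functions and have unbounded fan-out. -/
structure ClassicalCircuit (I O : Type) where
  size : ℕ
  fanIn : Fin size → ℕ
  fanIn_pos : ∀ g, 0 < fanIn g
  source : (g : Fin size) → Fin (fanIn g) → I ⊕ Fin g.val
  fn : (g : Fin size) → (Fin (fanIn g) → Bit) → Bit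
  output : O → I ⊕ Fin size

namespace ClassicalCircuit

variable {I O : Type}

/-- The value computed by a gate on the input `x`. -/
def gateValue (C : ClassicalCircuit I O) (x : I → Bit) (g : Fin C.size) : Bit :=
  C.fn g fun i =>
    match C.source g i with
    | .inl v => x v
    | .inr g' => C.gateValue x ⟨g'.val, g'.isLt.trans g.isLt⟩
termination_by g.val
decreasing_by exact g'.isLt

/-- The function computed by the circuit. -/
def eval (C : ClassicalCircuit I O) (x : I → Bit) (o : O) : Bit :=
  match C.output o with
  | .inl v => x v
  | .inr g => C.gateValue x g

/-- The maximal number of gates on a path from an input bit that ends with the gate `g`. -/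
def gateDepth (C : ClassicalCircuit I O) (g : Fin C.size) : ℕ :=
  1 + Finset.univ.sup fun i =>
    match C.source g i with
    | .inl _ => 0
    | .inr g' => C.gateDepth ⟨g'.val, g'.isLt.trans g.isLt⟩
termination_by g.val
decreasing_by exact g'.isLt

/-- The maximal number of gates on a path from an input bit to an output bit. -/
def depth [Fintype O] (C : ClassicalCircuit I O) : ℕ :=
  Finset.univ.sup fun o =>
    match C.output o with
    | .inl _ => 0
    | .inr g => C.gateDepth g

/-- All gates have fan-in at most `K`. -/
def FanInAtMost (C : ClassicalCircuit I O) (K : ℕ) : Prop := ∀ g, C.fanIn g ≤ K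

end ClassicalCircuit

open Classical in
/-- The success probability of a probabilistic circuit, which reads a problem instance `b` and `r`
random bits with distribution `μ`, on the relation `R`, for `b` uniform in `S`. -/
noncomputable def successProbability {V O : Type} {r : ℕ} (C : ClassicalCircuit (V ⊕ Fin r) O)
    (μ : PMF (Fin r → Bit)) (S : Finset (V → Bit)) (R : (V → Bit) → (O → Bit) → Prop) : ℝ :=
  (∑ b ∈ S, ∑ ρ : Fin r → Bit, if R b (C.eval (Sum.elim b ρ)) then (μ ρ).toReal else 0) / S.card

end MagicSquare

open MagicSquare

namespace MagicSquare

/-! Quantum side. On an input of `S` with `α` at `j` and `β` at `k`, a stabilizer of the initial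
state is pushed through the circuit. It becomes the entry of the Magic Square in row `α` and column
`β`, placed on both halves of every Bell pair from `j` to `k`. Alice's and Bob's gates make it
diagonal at the two ends, and the Bell measurements make it diagonal in between. What remains is a
Z-type operator with the sign `(-1)^(β 0 * β 1)`, so every `z` of non-zero amplitude obeys one
linear equation (`msUnitary_parity`).

Classical side. Sum the nine equations at a fixed pair `j < k`. The right-hand sides sum to 1, since
only the column 11 contributes, once for each of the three rows. On the left, the labels in a row or
in a column of the square sum to zero, so an output bit which ignores `β` or ignores `α` contributes
nothing. At the two ends the end bits must ignore the opposite party. Hence local outputs violate at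
least one of the nine equations (`exists_parity_ne`).

Noise tolerance. Conjugation by the encoded circuit sends Pauli operators to Pauli operators, and in
constant depth each block of the image depends on boundedly many blocks and control bits
(`CtrlCircuit.exists_blockLocal_run`). The decoded bits therefore depend on few input bits as soon
as the bits of `s` and `y` do (`exists_local_decoding`).

Counting. If every decoded bit sees at most `s` input bits, at most `4n(s+1)²` pairs `(j, k)` are
jointly seen by one decoded bit. Below the stated depth this is at most a tenth of all pairs
(`exists_lightcone_bound`). On all other pairs at most 8 of the 9 inputs succeed for each value of
the random bits, and `(8 + 1/10)/9 = 9/10`. -/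

/-! ## Sign characters and Pauli labels -/

/-- The sign `(-1)^a`. -/
def sgn (a : Bit) : ℂ := (-1) ^ a.val

@[simp] theorem sgn_zero : sgn 0 = 1 := by simp [sgn]

@[simp] theorem sgn_one : sgn 1 = -1 := by simp [sgn, ZMod.val_one]

theorem bit_eq_zero_or_one (a : Bit) : a = 0 ∨ a = 1 := by revert a; decide

theorem sgn_add (a b : Bit) : sgn (a + b) = sgn a * sgn b := by
  rcases bit_eq_zero_or_one a with rfl | rfl <;> rcases bit_eq_zero_or_one b with rfl | rfl <;>
    simp [show (1 + 1 : Bit) = 0 from rfl]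

theorem norm_sgn (a : Bit) : ‖sgn a‖ = 1 := by
  rcases bit_eq_zero_or_one a with rfl | rfl <;> simp

theorem sgn_ne_zero (a : Bit) : sgn a ≠ 0 := by
  rw [← norm_ne_zero_iff, norm_sgn]; exact one_ne_zero

theorem sgn_injective : Function.Injective sgn := by
  intro a b
  rcases bit_eq_zero_or_one a with rfl | rfl <;> rcases bit_eq_zero_or_one b with rfl | rfl <;>
    norm_num

theorem add_eq_iff_eq_add {Q : Type} (x y f : Q → Bit) : x = y + f ↔ x + f = y := by
  have hf : f + f = 0 := funext fun q => CharTwo.add_self_eq_zero (f q)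
  constructor
  · rintro rfl; rw [add_assoc, hf, add_zero]
  · rintro rfl; rw [add_assoc, hf, add_zero]

/-- A Pauli operator modulo phases: `(1, 0)` stands for `X`, `(0, 1)` for `Z`. -/
abbrev Label (Q : Type) := Q → Bit × Bit

/-! ### Intertwining relations between operators and Pauli labels. -/

section Pauli

variable {Q : Type} [Fintype Q] [DecidableEq Q]

/-- The Pauli operator of a label. -/
def pauli (p : Label Q) : Op Q := pauliXZ (fun q => (p q).1) fun q => (p q).2

theorem mul_pauliXZ_apply (A : Op Q) (f h x y : Q → Bit) :
    (A * pauliXZ f h) x y = A x (y + f) * sgn (h ⬝ᵥ y) := by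
  simp [Matrix.mul_apply, pauliXZ, sgn]

theorem pauliXZ_mul_apply (A : Op Q) (f h x y : Q → Bit) :
    (pauliXZ f h * A) x y = sgn (h ⬝ᵥ (x + f)) * A (x + f) y := by
  simp [Matrix.mul_apply, pauliXZ, sgn, add_eq_iff_eq_add]

/-- Conjugation by `A` takes the Pauli operator of `p` to `c` times the Pauli operator of `p'`. -/
def Intertwines (A : Op Q) (c : ℂ) (p p' : Label Q) : Prop :=
  A * pauli p = c • (pauli p' * A)

/-- Pauli operators are signed permutation matrices, so multiplying by one only shifts an index and
inserts a sign. For a concrete gate the relation then reduces to identities between bits. -/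
theorem intertwines_iff {A : Op Q} {c : ℂ} {p p' : Label Q} :
    Intertwines A c p p' ↔ ∀ x y : Q → Bit,
      A x (y + fun q => (p q).1) * sgn ((fun q => (p q).2) ⬝ᵥ y) =
        c * (sgn ((fun q => (p' q).2) ⬝ᵥ (x + fun q => (p' q).1)) *
          A (x + fun q => (p' q).1) y) := by
  rw [Intertwines, ← Matrix.ext_iff]
  simp only [pauli, mul_pauliXZ_apply, pauliXZ_mul_apply, Matrix.smul_apply, smul_eq_mul]

theorem Intertwines.mul {A B : Op Q} {c d : ℂ} {p p' p'' : Label Q}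
    (hB : Intertwines B d p' p'') (hA : Intertwines A c p p') :
    Intertwines (B * A) (d * c) p p'' := by
  unfold Intertwines at *
  rw [Matrix.mul_assoc, hA, Matrix.mul_smul, ← Matrix.mul_assoc, hB, Matrix.smul_mul, smul_smul,
    Matrix.mul_assoc, mul_comm c d]

theorem Intertwines.one (p : Label Q) : Intertwines (1 : Op Q) 1 p p := by
  simp [Intertwines]

theorem Intertwines.one_of_eq {p p' : Label Q} (h : p' = p) : Intertwines (1 : Op Q) 1 p p' :=
  h ▸ Intertwines.one p

theorem pauli_zero : pauli (0 : Label Q) = 1 := by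
  ext x y
  simp [pauli, pauliXZ, Matrix.one_apply, dotProduct]
  congr 1
  simp [funext_iff]

/-- The identity commutes with every operator, so a gate met only by the trivial label need not be
identified. -/
theorem Intertwines.of_eq_zero (A : Op Q) {p p' : Label Q} (h : p = 0) (h' : p' = 0) :
    Intertwines A 1 p p' := by
  subst h h'
  simp [Intertwines, pauli_zero]

open Classical in
theorem dotProduct_eq_add_of_injective {ι : Type} [Fintype ι] {w : ι → Q}
    (hw : Function.Injective w) (h y : Q → Bit) :
    h ⬝ᵥ y = (h ∘ w) ⬝ᵥ (y ∘ w) + ∑ q with q ∉ Set.range w, h q * y q := by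
  simp only [dotProduct, Function.comp]
  rw [← Finset.sum_filter_add_sum_filter_not Finset.univ (fun q => q ∈ Set.range w)]
  congr 1
  symm
  refine Finset.sum_bij (fun i _ => w i) ?_ ?_ ?_ ?_
  · simp
  · intro a _ b _ h; exact hw h
  · intro b hb
    obtain ⟨i, hi⟩ := (Finset.mem_filter.1 hb).2
    exact ⟨i, Finset.mem_univ _, hi⟩
  · simp

/-- Entries of the extended gate vanish unless both indices agree off the wires. There the common
label shifts both indices equally and gives both sides the same sign, which leaves the relation for
`G`. -/
theorem Intertwines.onWires {ι : Type} [Fintype ι] [DecidableEq ι] {w : ι → Q}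
    (hw : Function.Injective w) {G : Op ι} {c : ℂ} {p p' : Label Q}
    (hG : Intertwines G c (p ∘ w) (p' ∘ w)) (h : ∀ q, q ∉ Set.range w → p' q = p q) :
    Intertwines (onWires w G) c p p' := by
  classical
  rw [intertwines_iff] at hG ⊢
  intro x y
  have hc : (∀ q, q ∉ Set.range w → x q = (y + fun q => (p q).1) q) ↔
      ∀ q, q ∉ Set.range w → (x + fun q => (p' q).1) q = y q := by
    refine forall₂_congr fun q hq => ?_
    simp only [Pi.add_apply, h q hq]
    constructor
    · rintro h; rw [h, add_assoc, CharTwo.add_self_eq_zero, add_zero]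
    · rintro h; rw [← h, add_assoc, CharTwo.add_self_eq_zero, add_zero]
  by_cases hx : ∀ q, q ∉ Set.range w → (x + fun q => (p' q).1) q = y q
  · rw [MagicSquare.onWires, MagicSquare.onWires, if_pos hx, if_pos (hc.2 hx),
      dotProduct_eq_add_of_injective hw _ y, dotProduct_eq_add_of_injective hw _ (x + _),
      sgn_add, sgn_add]
    have h1 : ∑ q with q ∉ Set.range w, (p' q).2 * (x + fun q => (p' q).1) q =
        ∑ q with q ∉ Set.range w, (p q).2 * y q := by
      refine Finset.sum_congr rfl fun q hq => ?_
      rw [hx q (Finset.mem_filter.1 hq).2, h q (Finset.mem_filter.1 hq).2]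
    have h2 := hG (x ∘ w) (y ∘ w)
    rw [h1]
    calc _ = (G (x ∘ w) (y ∘ w + fun q => ((p ∘ w) q).1) *
          sgn ((fun q => ((p ∘ w) q).2) ⬝ᵥ (y ∘ w))) *
          sgn (∑ q with q ∉ Set.range w, (p q).2 * y q) := by rw [mul_assoc]; rfl
      _ = _ := by
        rw [h2, mul_assoc, mul_assoc, mul_assoc, mul_comm (G _ _)]
        rfl
  · rw [MagicSquare.onWires, MagicSquare.onWires, if_neg hx, if_neg (mt hc.1 hx)]
    simp

/-- While gates on disjoint supports are applied one by one, the current label is a hybrid of `p`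
and `p'`. The hypothesis on a gate thus fixes its labels only on its own support and asks for
agreement elsewhere. -/
theorem Intertwines.list_prod {ι : Type} (S : ι → Set Q) (g : ι → Op Q) (c : ι → ℂ)
    {l : List ι} (hl : l.Pairwise fun i j => Disjoint (S i) (S j)) {p p' : Label Q}
    (hg : ∀ i ∈ l, ∀ p₁ p₂ : Label Q, (∀ q ∈ S i, p₁ q = p q) → (∀ q ∈ S i, p₂ q = p' q) →
      (∀ q, q ∉ S i → p₂ q = p₁ q) → Intertwines (g i) (c i) p₁ p₂)
    (hoff : ∀ q, (∀ i ∈ l, q ∉ S i) → p' q = p q) :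
    Intertwines (l.map g).prod (l.map c).prod p p' := by
  classical
  induction l generalizing p' with
  | nil =>
    obtain rfl : p' = p := funext fun q => hoff q (by simp)
    simpa using Intertwines.one p'
  | cons i l ih =>
    rw [List.pairwise_cons] at hl
    simp only [List.map_cons, List.prod_cons]
    -- The head of the list is the leftmost factor and acts last: just before it, only its own
    -- support still carries `p`.
    set p₁ : Label Q := fun q => if q ∈ S i then p q else p' q with hp₁
    refine Intertwines.mul (p' := p₁) (hg i (by simp) _ _ ?_ ?_ ?_) (ih hl.2 ?_ ?_)
    · intro q hq; simp [hp₁, hq]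
    · intro q _; rfl
    · intro q hq; simp [hp₁, hq]
    · intro i' hi' q₁ q₂ h1 h2 h3
      refine hg i' (by simp [hi']) q₁ q₂ h1 (fun q hq => ?_) h3
      rw [h2 q hq, hp₁]
      exact if_neg (Set.disjoint_right.1 (hl.1 i' hi') hq)
    · intro q hq
      by_cases hqi : q ∈ S i
      · simp [hp₁, hqi]
      · simp only [hp₁, hqi, if_false]
        refine hoff q fun i' hi' => ?_
        rcases List.mem_cons.1 hi' with rfl | h
        · exact hqi
        · exact hq i' h

end Pauli

/-! ## Elementary gates -/

/-- The sign comes from restoring the order X before Z: `H X^f Z^h H = Z^f X^h = (-1)^(fh) X^h Z^f`.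
-/
theorem intertwines_gateH {p p' : Label (Fin 1)} (h : p' 0 = (p 0).swap) :
    Intertwines gateH (sgn ((p 0).1 * (p 0).2)) p p' := by
  rw [intertwines_iff]
  intro x y
  simp only [gateH, dotProduct, Fin.sum_univ_one, Pi.add_apply, h, Prod.fst_swap, Prod.snd_swap]
  generalize x 0 = a, y 0 = b, (p 0).1 = f, (p 0).2 = h
  change _ * sgn _ * _ = _ * (_ * (_ * sgn _))
  have : sgn (a * (b + f)) * sgn (h * b) = sgn (f * h) * (sgn (f * (a + h)) * sgn ((a + h) * b)) := by
    rw [← sgn_add, ← sgn_add, ← sgn_add]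
    congr 1
    revert a b f h
    decide
  linear_combination (((Real.sqrt 2)⁻¹ : ℝ) : ℂ) * this

theorem intertwines_gateCNOT {p p' : Label (Fin 2)} (h0 : p' 0 = ((p 0).1, (p 0).2 + (p 1).2))
    (h1 : p' 1 = ((p 1).1 + (p 0).1, (p 1).2)) :
    Intertwines gateCNOT 1 p p' := by
  rw [intertwines_iff]
  intro x y
  simp only [gateCNOT, dotProduct, Fin.sum_univ_two, Pi.add_apply, h0, h1]
  have hc : ∀ a b a' b' f f' : Bit,
      (a = b + f ∧ a' = b' + f' + (b + f)) ↔ (a + f = b ∧ a' + (f' + f) = b' + b) := by decide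
  have hs : ∀ b b' h h' : Bit, h * b + h' * b' = (h + h') * b + h' * (b' + b) := by decide
  replace hc := hc (x 0) (y 0) (x 1) (y 1) (p 0).1 (p 1).1
  by_cases hx : x 0 + (p 0).1 = y 0 ∧ x 1 + ((p 1).1 + (p 0).1) = y 1 + y 0
  · rw [if_pos hx, if_pos (hc.2 hx), hx.1, hx.2, hs]
    ring
  · rw [if_neg hx, if_neg (mt hc.1 hx)]; simp

theorem intertwines_gateSWAP {p p' : Label (Fin 2)} (h0 : p' 0 = p 1) (h1 : p' 1 = p 0) :
    Intertwines gateSWAP 1 p p' := by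
  rw [intertwines_iff]
  intro x y
  simp only [gateSWAP, dotProduct, Fin.sum_univ_two, Pi.add_apply, h0, h1]
  have hc : ∀ a b a' b' f f' : Bit, (a = b' + f' ∧ a' = b + f) ↔ (a + f' = b' ∧ a' + f = b) := by
    decide
  replace hc := hc (x 0) (y 0) (x 1) (y 1) (p 0).1 (p 1).1
  by_cases hx : x 0 + (p 1).1 = y 1 ∧ x 1 + (p 0).1 = y 0
  · rw [if_pos hx, if_pos (hc.2 hx), hx.1, hx.2, add_comm ((p 0).2 * y 0)]
    ring
  · rw [if_neg hx, if_neg (mt hc.1 hx)]; simp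

theorem intertwines_gateCZ {p p' : Label (Fin 2)} (h0 : p' 0 = ((p 0).1, (p 0).2 + (p 1).1))
    (h1 : p' 1 = ((p 1).1, (p 1).2 + (p 0).1)) :
    Intertwines gateCZ (sgn ((p 0).1 * (p 1).1)) p p' := by
  rw [intertwines_iff]
  intro x y
  simp only [gateCZ, dotProduct, Fin.sum_univ_two, Pi.add_apply, h0, h1]
  have hc : (x = y + fun q => (p q).1) ↔ (x + fun q => (p' q).1) = y := by
    rw [add_eq_iff_eq_add]
    have : (fun q => (p q).1) = fun q => (p' q).1 := by
      ext q; fin_cases q <;> simp [h0, h1]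
    rw [this]
  by_cases hx : (x + fun q => (p' q).1) = y
  · rw [if_pos hx, if_pos (hc.2 hx)]
    have e0 : x 0 + (p 0).1 = y 0 := by rw [← hx]; simp [h0]
    have e1 : x 1 + (p 1).1 = y 1 := by rw [← hx]; simp [h1]
    change sgn _ * _ = _ * (_ * sgn _)
    rw [← sgn_add, ← sgn_add, ← sgn_add, ← e0, ← e1]
    congr 1
    generalize x 0 = a, x 1 = a', (p 0).1 = f, (p 0).2 = h, (p 1).1 = f', (p 1).2 = h'
    revert a a' f h f' h'
    decide
  · rw [if_neg hx, if_neg (mt hc.1 hx)]; simp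

theorem intertwines_pauliXZ_zero {Q : Type} [Fintype Q] [DecidableEq Q] (h : Q → Bit)
    (p : Label Q) : Intertwines (pauliXZ 0 h) (sgn (∑ q, h q * (p q).1)) p p := by
  rw [intertwines_iff]
  intro x y
  simp only [pauliXZ, add_zero]
  by_cases hx : (x + fun q => (p q).1) = y
  · rw [if_pos hx, if_pos ((add_eq_iff_eq_add _ _ _).2 hx), hx]
    change sgn _ * _ = _ * (_ * sgn _)
    rw [← sgn_add, ← sgn_add, ← sgn_add]
    congr 1
    simp only [dotProduct, Pi.add_apply, mul_add, Finset.sum_add_distrib]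
    ring
  · rw [if_neg hx, if_neg (mt (add_eq_iff_eq_add _ _ _).1 hx)]; simp

theorem pair_injective {Q : Type} {c t : Q} (h : c ≠ t) : Function.Injective ![c, t] := by
  intro i j hij
  fin_cases i <;> fin_cases j <;> simp_all

theorem single_injective {Q : Type} (q : Q) : Function.Injective ![q] :=
  fun _ _ _ => Subsingleton.elim _ _

section Wires

variable {Q : Type} [Fintype Q] [DecidableEq Q] {p p' : Label Q}

theorem intertwines_onWires_gateH (q : Q) (h : p' q = (p q).swap)
    (h' : ∀ r, r ≠ q → p' r = p r) :
    Intertwines (onWires ![q] gateH) (sgn ((p q).1 * (p q).2)) p p' :=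
  Intertwines.onWires (single_injective q) (intertwines_gateH (p := p ∘ ![q]) (by simpa using h))
    (fun r hr => h' r (by simpa [eq_comm] using hr))

theorem intertwines_onWires_gateCNOT {c t : Q} (hne : c ≠ t)
    (h0 : p' c = ((p c).1, (p c).2 + (p t).2)) (h1 : p' t = ((p t).1 + (p c).1, (p t).2))
    (h' : ∀ r, r ≠ c → r ≠ t → p' r = p r) :
    Intertwines (onWires ![c, t] gateCNOT) 1 p p' := by
  refine Intertwines.onWires (pair_injective hne) (intertwines_gateCNOT (by simpa using h0)
    (by simpa using h1)) fun r hr => ?_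
  simp only [Matrix.range_cons, Matrix.range_empty, Set.union_empty, Set.mem_union,
    Set.mem_singleton_iff, not_or] at hr
  exact h' r hr.1 hr.2

end Wires

/-! ## The Magic Square -/

/-- The entry of the Magic Square in the row `α` and the column `β`, up to a sign. -/
def squareLabel (α β : Fin 2 → Bit) : Label (Fin 2) :=
  ![(α 1 * β 1, α 0 * β 0), (α 0 * β 1, α 1 * β 0)]

/-- The label of the operator `Z(a₁, a₀)`. -/
def zLabel (a : Fin 2 → Bit) : Label (Fin 2) := ![(0, a 1), (0, a 0)]

theorem eq_of_ne_zero_bitPair {a : Fin 2 → Bit} (h : a ≠ 0) :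
    a = ![0, 1] ∨ a = ![1, 0] ∨ a = ![1, 1] := by
  revert a; decide

/-- Row 01 consists of `X^{β₁} ⊗ Z^{β₀}`. SWAP and CNOT bring the rows 10 and 11 to this form, and a
Hadamard gate on the first qubit makes it diagonal. No row produces a sign. -/
theorem intertwines_gateU {α : Fin 2 → Bit} (hα : α ≠ 0) (β : Fin 2 → Bit) {p p' : Label (Fin 2)}
    (hp : p = squareLabel α β) (hp' : p' = zLabel β) : Intertwines (gateU α) 1 p p' := by
  subst hp hp'
  have hH : Intertwines (onWires ![0] gateH) 1 ![(β 1, 0), (0, β 0)] (zLabel β) := by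
    have := intertwines_onWires_gateH (p := ![(β 1, 0), (0, β 0)]) (p' := zLabel β) 0
      (by simp [zLabel]) (by intro r hr; fin_cases r <;> simp_all [zLabel])
    simpa using this
  rcases eq_of_ne_zero_bitPair hα with rfl | rfl | rfl
  · simpa [gateU, squareLabel] using hH
  · have := hH.mul (intertwines_gateSWAP (p := squareLabel ![1, 0] β)
      (by simp [squareLabel]) (by simp [squareLabel]))
    simpa [gateU] using this
  · have := hH.mul (intertwines_gateCNOT (p := squareLabel ![1, 1] β)
      (by simp [squareLabel, CharTwo.add_self_eq_zero])
      (by simp [squareLabel, CharTwo.add_self_eq_zero]))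
    simpa [gateU] using this

/-- Column 11 is the only one with a sign: `Z ⊗ Z` contributes `α₀ + α₁` and CZ contributes `α₀α₁`,
and the total is the OR of the two bits, which is 1 for `α ≠ 0`. This sign is the obstruction to
classical strategies. -/
theorem intertwines_gateV {α β : Fin 2 → Bit} (hα : α ≠ 0) (hβ : β ≠ 0) {p p' : Label (Fin 2)}
    (hp : p = squareLabel α β) (hp' : p' = zLabel α) :
    Intertwines (gateV β) (sgn (β 0 * β 1)) p p' := by
  subst hp hp'
  have hH : Intertwines (onWires ![0] gateH * onWires ![1] gateH) 1 ![(α 1, 0), (α 0, 0)]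
      (zLabel α) := by
    have h1 := intertwines_onWires_gateH (p := ![(α 1, 0), (α 0, 0)])
      (p' := ![(α 1, 0), (0, α 0)]) 1 (by simp) (by intro r hr; fin_cases r <;> simp_all)
    have h0 := intertwines_onWires_gateH (p := ![(α 1, 0), (0, α 0)]) (p' := zLabel α) 0
      (by simp [zLabel]) (by intro r hr; fin_cases r <;> simp_all [zLabel])
    simpa using h0.mul h1
  rcases eq_of_ne_zero_bitPair hβ with rfl | rfl | rfl
  · simpa [gateV, squareLabel] using hH
  · have := intertwines_gateSWAP (p := squareLabel α ![1, 0]) (p' := zLabel α)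
      (by simp [squareLabel, zLabel]) (by simp [squareLabel, zLabel])
    simpa [gateV] using this
  · have h1 := intertwines_pauliXZ_zero 1 (squareLabel α ![1, 1])
    have h2 := intertwines_gateCZ (p := squareLabel α ![1, 1]) (p' := ![(α 1, 0), (α 0, 0)])
      (by simp [squareLabel, CharTwo.add_self_eq_zero])
      (by simp [squareLabel, CharTwo.add_self_eq_zero])
    have h3 := (hH.mul h2).mul h1
    have hs : ∀ a : Fin 2 → Bit, a ≠ 0 → a 1 * a 0 + (a 1 + a 0) = 1 := by decide
    have hs' := hs α hα
    rw [one_mul, ← sgn_add] at h3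
    simp only [squareLabel, Matrix.cons_val_zero, Matrix.cons_val_one, mul_one, Fin.sum_univ_two,
      Pi.one_apply, one_mul, hs'] at h3
    simpa [gateV, squareLabel] using h3

/-- The Bell basis diagonalizes `X ⊗ X` and `Z ⊗ Z` together: the X exponent of `P ⊗ P` moves to the
first qubit and the Z exponent to the second, both as powers of Z. -/
theorem intertwines_gateM {p p' : Label (Fin 2)} (h : p 0 = p 1) (h0 : p' 0 = (0, (p 0).1))
    (h1 : p' 1 = (0, (p 0).2)) : Intertwines gateM 1 p p' := by
  have hC := intertwines_gateCNOT (p := p) (p' := ![((p 0).1, 0), (0, (p 0).2)])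
    (by simp [← h, CharTwo.add_self_eq_zero]) (by simp [← h, CharTwo.add_self_eq_zero])
  have hH := intertwines_onWires_gateH (p := ![((p 0).1, 0), (0, (p 0).2)]) (p' := p') 0
    (by simp [h0]) (by intro r hr; fin_cases r <;> simp_all)
  simpa [gateM] using hH.mul hC

theorem intertwines_gateW_zero {p p' : Label (Fin 4)} (h02 : p 0 = p 2) (h13 : p 1 = p 3)
    (h0 : p' 0 = (0, (p 0).1)) (h1 : p' 1 = (0, (p 1).1)) (h2 : p' 2 = (0, (p 0).2))
    (h3 : p' 3 = (0, (p 1).2)) : Intertwines (gateW 0 0) 1 p p' := by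
  have i13 : Function.Injective ![(1 : Fin 4), 3] := by decide
  have i02 : Function.Injective ![(0 : Fin 4), 2] := by decide
  have a13 := Intertwines.onWires i13 (p := p) (p' := ![p 0, (0, (p 1).1), p 0, (0, (p 1).2)])
    (intertwines_gateM (by simpa using h13) (by simp) (by simp))
    (by intro r hr; fin_cases r <;> simp_all)
  have a02 := Intertwines.onWires i02 (p := ![p 0, (0, (p 1).1), p 0, (0, (p 1).2)]) (p' := p')
    (intertwines_gateM (by simp) (by simp [h0]) (by simp [h2]))
    (by intro r hr; fin_cases r <;> simp_all)
  simpa [gateW] using a02.mul a13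

/-! ## Stabilizers of the 1D Magic Square circuit -/

section Stabilizer

variable {n : ℕ}

theorem pairwise_disjoint_finRange {Q : Type} {S : Fin n → Set Q}
    (hS : ∀ i j q, q ∈ S i → q ∈ S j → i = j) :
    (List.finRange n).Pairwise fun i j => Disjoint (S i) (S j) :=
  (List.nodup_finRange n).imp fun {_ _} hne =>
    Set.disjoint_left.2 fun q hi hj => hne (hS _ _ q hi hj)

theorem forall_of_position {R : MSIndex n → Prop} (i : Fin n) (h : ∀ q, q.1 ≠ i → R q)
    (h00 : R (i, 0, 0)) (h01 : R (i, 0, 1)) (h10 : R (i, 1, 0)) (h11 : R (i, 1, 1)) (q) : R q := by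
  obtain ⟨i', s, e⟩ := q
  by_cases hi : i' = i
  · subst hi
    fin_cases s <;> fin_cases e <;> assumption
  · exact h _ hi

/-- The Pauli operator with the label `P` on all pairs of qubits between the positions `j`
and `k`. -/
def segmentLabel (j k : Fin n) (P : Label (Fin 2)) : Label (MSIndex n) :=
  fun q => if j ≤ q.1 ∧ q.1 ≤ k then P q.2.2 else 0

/-- The operator `segmentLabel j k P` before the Bell pairs are prepared. -/
def preparationLabel (j k : Fin n) (P : Label (Fin 2)) : Label (MSIndex n) :=
  fun q => if j ≤ q.1 ∧ q.1 ≤ k then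
    (0, if q.2.1 = 0 then (P q.2.2).1 else (P q.2.2).2) else 0

/-- A Bell pair is stabilized by `X ⊗ X` and `Z ⊗ Z`, the images of Z on the control and Z on the
target. Hence `P ⊗ P` comes from a Z-type operator, which fixes the all-zero state. -/
theorem intertwines_bellPreparation (j k : Fin n) (P : Label (Fin 2)) :
    Intertwines (((List.finRange n).map fun j =>
      onWires ![((j, 0, 0) : MSIndex n), (j, 1, 0)] gateCNOT *
        onWires ![((j, 0, 1) : MSIndex n), (j, 1, 1)] gateCNOT).prod *
      ((List.finRange n).map fun j =>
        onWires ![((j, 0, 0) : MSIndex n)] gateH *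
          onWires ![((j, 0, 1) : MSIndex n)] gateH).prod) 1
      (preparationLabel j k P) (segmentLabel j k P) := by
  set p : Label (MSIndex n) := fun q => if j ≤ q.1 ∧ q.1 ≤ k then
    (if q.2.1 = 0 then ((P q.2.2).1, 0) else (0, (P q.2.2).2)) else 0 with hp
  rw [← one_mul (1 : ℂ)]
  refine Intertwines.mul (p' := p) ?_ ?_
  · have := Intertwines.list_prod (fun i : Fin n => {q : MSIndex n | q.1 = i})
      (fun j => onWires ![((j, 0, 0) : MSIndex n), (j, 1, 0)] gateCNOT *
        onWires ![((j, 0, 1) : MSIndex n), (j, 1, 1)] gateCNOT) (fun _ => 1)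
      (l := List.finRange n) (pairwise_disjoint_finRange (by simp +contextual))
      (p := p) (p' := segmentLabel j k P) ?_ (by simp)
    · simpa using this
    · intro i _ p₁ p₂ h1 h2 h3
      simp only [Set.mem_ofPred_eq] at h1 h2 h3
      rw [← one_mul (1 : ℂ)]
      have hc : ∀ e, p₂ (i, 0, e) = ((p₁ (i, 0, e)).1, (p₁ (i, 0, e)).2 + (p₁ (i, 1, e)).2) := by
        intro e
        simp only [h1, h2, segmentLabel, hp]
        split_ifs <;> simp_all [Prod.ext_iff]
      have ht : ∀ e, p₂ (i, 1, e) = ((p₁ (i, 1, e)).1 + (p₁ (i, 0, e)).1, (p₁ (i, 1, e)).2) := by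
        intro e
        simp only [h1, h2, segmentLabel, hp]
        split_ifs <;> simp_all [Prod.ext_iff]
      clear h1 h2
      refine Intertwines.mul (p' := fun q => if q.2.2 = 0 then p₁ q else p₂ q) ?_ ?_
      · refine intertwines_onWires_gateCNOT (by simp) (by simpa using hc 0) (by simpa using ht 0)
          (forall_of_position i (fun q hq => ?_) ?_ ?_ ?_ ?_)
        · simp [h3 q hq]
        all_goals simp
      · refine intertwines_onWires_gateCNOT (by simp) (by simpa using hc 1) (by simpa using ht 1)
          (forall_of_position i (fun q hq => ?_) ?_ ?_ ?_ ?_)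
        · simp [h3 q hq]
        all_goals simp
  · have := Intertwines.list_prod (fun i : Fin n => {q : MSIndex n | q.1 = i})
      (fun j => onWires ![((j, 0, 0) : MSIndex n)] gateH *
          onWires ![((j, 0, 1) : MSIndex n)] gateH) (fun _ => 1)
      (l := List.finRange n) (pairwise_disjoint_finRange (by simp +contextual))
      (p := preparationLabel j k P) (p' := p) ?_ (by simp)
    · simpa using this
    · intro i _ p₁ p₂ h1 h2 h3
      simp only [Set.mem_ofPred_eq] at h1 h2 h3
      have e0 : (p₁ (i, 0, 0)).1 = 0 := by
        rw [h1 _ rfl, preparationLabel]; split_ifs <;> rfl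
      have e1 : (p₁ (i, 0, 1)).1 = 0 := by
        rw [h1 _ rfl, preparationLabel]; split_ifs <;> rfl
      have a0 : ∀ e, p₂ (i, 0, e) = (p₁ (i, 0, e)).swap := by
        intro e
        simp only [h1, h2, preparationLabel, hp]; split_ifs <;> simp_all [Prod.ext_iff]
      have a1 : ∀ e, p₂ (i, 1, e) = p₁ (i, 1, e) := by
        intro e
        simp only [h1, h2, preparationLabel, hp]; split_ifs <;> simp_all
      clear h1 h2
      have b1 := intertwines_onWires_gateH (p := p₁)
        (p' := fun q => if q = (i, 0, 1) then p₂ q else p₁ q) (i, 0, 1) (by simpa using a0 1)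
        (by intro r hr; simp [hr])
      have b0 := intertwines_onWires_gateH (p := fun q => if q = (i, 0, 1) then p₂ q else p₁ q)
        (p' := p₂) (i, 0, 0) (by simpa using a0 0)
        (forall_of_position i (fun q hq => by simp [h3 q hq]) (by simp) (by simp)
          (by simp [a1]) (by simp [a1]))
      simpa [e0, e1] using b0.mul b1

/-- The operator `segmentLabel j k P` after Alice's and Bob's gates. -/
def rotatedLabel (j k : Fin n) (α β : Fin 2 → Bit) : Label (MSIndex n) := fun q =>
  if q.2.1 = 0 then
    if q.1 = j then zLabel β q.2.2 else segmentLabel j k (squareLabel α β) q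
  else
    if q.1 = k then zLabel α q.2.2 else segmentLabel j k (squareLabel α β) q

/-- The output bits which enter the parity that is determined by the inputs `α` at `j`, `β`
at `k`. -/
def parityWeight (j k : Fin n) (α β : Fin 2 → Bit) (q : MSIndex n) : Bit :=
  if q.2.1 = 0 then
    if q.1 = j then (zLabel β q.2.2).2
    else (segmentLabel j k (squareLabel α β) q).2
  else
    if q.1 = k then (zLabel α q.2.2).2
    else (segmentLabel j k (squareLabel α β) q).1

/-- Only Alice's gate at `j` and Bob's gate at `k` are not the identity, and `j < k` puts both
positions inside the segment. The sign is Bob's. -/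
theorem intertwines_rotations {j k : Fin n} (hjk : j < k) {α β : Fin 2 → Bit} (hα : α ≠ 0)
    (hβ : β ≠ 0) {b : MSIndex n → Bit}
    (hA : ∀ i, (fun e => b (i, 0, e)) = if i = j then α else 0)
    (hB : ∀ i, (fun e => b (i, 1, e)) = if i = k then β else 0) :
    Intertwines ((List.finRange n).map fun j =>
      onWires ![((j, 0, 0) : MSIndex n), (j, 0, 1)] (gateU fun i => b (j, 0, i)) *
        onWires ![((j, 1, 0) : MSIndex n), (j, 1, 1)] (gateV fun i => b (j, 1, i))).prod
      (sgn (β 0 * β 1)) (segmentLabel j k (squareLabel α β)) (rotatedLabel j k α β) := by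
  have := Intertwines.list_prod (fun i : Fin n => {q : MSIndex n | q.1 = i})
    (fun j => onWires ![((j, 0, 0) : MSIndex n), (j, 0, 1)] (gateU fun i => b (j, 0, i)) *
        onWires ![((j, 1, 0) : MSIndex n), (j, 1, 1)] (gateV fun i => b (j, 1, i)))
    (fun i => if i = k then sgn (β 0 * β 1) else 1)
    (l := List.finRange n) (pairwise_disjoint_finRange (by simp +contextual))
    (p := segmentLabel j k (squareLabel α β)) (p' := rotatedLabel j k α β) ?_ (by simp)
  · rwa [← Fin.prod_univ_def, Finset.prod_ite_eq', if_pos (Finset.mem_univ _)] at this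
  · intro i _ p₁ p₂ h1 h2 h3
    simp only [Set.mem_ofPred_eq] at h1 h2 h3
    obtain ⟨c, hc⟩ : ∃ c, c = if i = k then sgn (β 0 * β 1) else 1 := ⟨_, rfl⟩
    rw [hA i, hB i, ← hc, ← one_mul c]
    refine Intertwines.mul (p' := fun q => if q.2.1 = 0 then p₁ q else p₂ q) ?_ ?_
    · refine Intertwines.onWires (pair_injective (by simp)) ?_
        (forall_of_position i (fun q hq => ?_) ?_ ?_ ?_ ?_)
      · by_cases hij : i = j
        · subst hij
          rw [if_pos rfl]
          refine intertwines_gateU hα β ?_ ?_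
          · ext1 e; fin_cases e <;> simp [h1, segmentLabel, hjk.le]
          · ext1 e; fin_cases e <;> simp [h2, rotatedLabel]
        · rw [if_neg hij]
          have : gateU 0 = 1 := by simp [gateU, funext_iff, Fin.forall_fin_two]
          rw [this]
          refine Intertwines.one_of_eq ?_
          ext1 e; fin_cases e <;> simp [h1, h2, rotatedLabel, hij]
      · simp [h3 q hq]
      all_goals simp
    · refine Intertwines.onWires (pair_injective (by simp)) ?_
        (forall_of_position i (fun q hq => ?_) ?_ ?_ ?_ ?_)
      · by_cases hik : i = k
        · subst hik
          rw [hc, if_pos rfl, if_pos rfl]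
          refine intertwines_gateV hα hβ ?_ ?_
          · ext1 e; fin_cases e <;> simp [h1, segmentLabel, hjk.le]
          · ext1 e; fin_cases e <;> simp [h2, rotatedLabel]
        · rw [hc, if_neg hik, if_neg hik]
          have : gateV 0 = 1 := by simp [gateV, funext_iff, Fin.forall_fin_two]
          rw [this]
          refine Intertwines.one_of_eq ?_
          ext1 e; fin_cases e <;> simp [h1, h2, rotatedLabel, hik]
      · simp [h3 q hq]
      all_goals simp

theorem quad_injective (i i' : Fin n) : Function.Injective
    ![((i, 1, 0) : MSIndex n), (i, 1, 1), (i', 0, 0), (i', 0, 1)] := by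
  intro x y h
  fin_cases x <;> fin_cases y <;> simp_all

/-- A swapping gate inside the segment sees equal labels on its two sides and is a Bell measurement.
Elsewhere it either meets the trivial label, or it is switched off by a non-zero input next to a
label which is already of Z type. -/
theorem intertwines_entanglementSwapping {j k : Fin n} {α β : Fin 2 → Bit}
    (hα : α ≠ 0) (hβ : β ≠ 0) {b : MSIndex n → Bit}
    (hA : ∀ i, (fun e => b (i, 0, e)) = if i = j then α else 0)
    (hB : ∀ i, (fun e => b (i, 1, e)) = if i = k then β else 0) :
    Intertwines ((List.finRange n).map fun j =>
      if hj : j.val + 1 < n then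
        onWires ![((j, 1, 0) : MSIndex n), (j, 1, 1), (⟨j.val + 1, hj⟩, 0, 0),
            (⟨j.val + 1, hj⟩, 0, 1)]
          (gateW (fun i => b (j, 1, i)) (fun i => b (⟨j.val + 1, hj⟩, 0, i)))
      else 1).prod 1 (rotatedLabel j k α β) (fun q => (0, parityWeight j k α β q)) := by
  have := Intertwines.list_prod
    (fun i : Fin n => {q : MSIndex n | q.1 = i ∧ q.2.1 = 1 ∨ q.1.val = i.val + 1 ∧ q.2.1 = 0})
    (fun j => if hj : j.val + 1 < n then
        onWires ![((j, 1, 0) : MSIndex n), (j, 1, 1), (⟨j.val + 1, hj⟩, 0, 0),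
            (⟨j.val + 1, hj⟩, 0, 1)]
          (gateW (fun i => b (j, 1, i)) (fun i => b (⟨j.val + 1, hj⟩, 0, i)))
      else 1)
    (fun _ => 1) (l := List.finRange n) (pairwise_disjoint_finRange ?_)
    (p := rotatedLabel j k α β) (p' := fun q => (0, parityWeight j k α β q)) ?_ ?_
  · simpa using this
  · rintro i i' ⟨a, s, e⟩ (⟨h, h'⟩ | ⟨h, h'⟩) (⟨h2, h2'⟩ | ⟨h2, h2'⟩) <;> dsimp only at h h' h2 h2'
    · exact h.symm.trans h2
    · rw [h'] at h2'; exact absurd h2' (by decide)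
    · rw [h'] at h2'; exact absurd h2' (by decide)
    · ext; omega
  · intro i _ p₁ p₂ h1 h2 h3
    simp only [Set.mem_ofPred_eq] at h1 h2 h3
    have h1' : ∀ e, p₁ (i, 1, e) = rotatedLabel j k α β (i, 1, e) := fun e => h1 _ (by simp)
    have h2' : ∀ e, p₂ (i, 1, e) = (0, parityWeight j k α β (i, 1, e)) := fun e => h2 _ (by simp)
    by_cases hi : i.val + 1 < n
    · rw [dif_pos hi, hA, hB]
      have g1 : ∀ e, p₁ (⟨i.val + 1, hi⟩, 0, e) = rotatedLabel j k α β (⟨i.val + 1, hi⟩, 0, e) :=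
        fun e => h1 _ (by simp)
      have g2 : ∀ e, p₂ (⟨i.val + 1, hi⟩, 0, e) =
          (0, parityWeight j k α β (⟨i.val + 1, hi⟩, 0, e)) := fun e => h2 _ (by simp)
      clear h1 h2
      refine Intertwines.onWires (quad_injective _ _) ?_ ?_
      · by_cases hs : j ≤ i ∧ i < k
        · have hk : i ≠ k := hs.2.ne
          have hj : (⟨i.val + 1, hi⟩ : Fin n) ≠ j := by
            intro h; have := Fin.le_def.1 hs.1; simp [Fin.ext_iff] at h; omega
          have s1 : j ≤ i ∧ i ≤ k := ⟨hs.1, hs.2.le⟩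
          have s2 : j ≤ (⟨i.val + 1, hi⟩ : Fin n) ∧ (⟨i.val + 1, hi⟩ : Fin n) ≤ k := by
            have := hs.1; have := hs.2
            simp only [Fin.le_def, Fin.lt_def] at *; omega
          rw [if_neg hk, if_neg hj]
          apply intertwines_gateW_zero
          all_goals
            simp [h1', h2', g1, g2, rotatedLabel, parityWeight, segmentLabel, hk, hj, s1, s2]
        · have a1 : ∀ e, p₂ (i, 1, e) = p₁ (i, 1, e) ∧ (i ≠ k → p₁ (i, 1, e) = 0) := by
            intro e
            have : i ≠ k → ¬ (j ≤ i ∧ i ≤ k) := fun h h' => hs ⟨h'.1, lt_of_le_of_ne h'.2 h⟩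
            by_cases hk : i = k
            · subst hk
              rw [h1', h2']
              simp only [rotatedLabel, parityWeight, zLabel]
              fin_cases e <;> simp
            · simp [h1', h2', rotatedLabel, parityWeight, segmentLabel, hk, this hk, Prod.ext_iff]
          have a0 : ∀ e, p₂ (⟨i.val + 1, hi⟩, 0, e) = p₁ (⟨i.val + 1, hi⟩, 0, e) ∧
              ((⟨i.val + 1, hi⟩ : Fin n) ≠ j → p₁ (⟨i.val + 1, hi⟩, 0, e) = 0) := by
            intro e
            have : (⟨i.val + 1, hi⟩ : Fin n) ≠ j →
                ¬ (j ≤ (⟨i.val + 1, hi⟩ : Fin n) ∧ (⟨i.val + 1, hi⟩ : Fin n) ≤ k) := by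
              intro h h'
              simp only [Fin.le_def, Fin.lt_def, Ne, Fin.ext_iff] at *; omega
            by_cases hj : (⟨i.val + 1, hi⟩ : Fin n) = j
            · rw [g1, g2]
              simp only [rotatedLabel, parityWeight, hj, zLabel]
              fin_cases e <;> simp
            · simp [g1, g2, rotatedLabel, parityWeight, segmentLabel, hj, this hj, Prod.ext_iff]
          -- Outside the segment: either all four labels vanish, or the gate touches Bob's end `k`
          -- or Alice's end `j` and is the identity.
          by_cases hW : i ≠ k ∧ (⟨i.val + 1, hi⟩ : Fin n) ≠ j
          · refine Intertwines.of_eq_zero _ ?_ ?_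
            · ext1 x
              fin_cases x <;> simp [(a1 _).2 hW.1, (a0 _).2 hW.2]
            · ext1 x
              fin_cases x <;> simp [(a1 _).1, (a0 _).1, (a1 _).2 hW.1, (a0 _).2 hW.2]
          · have : gateW (if i = k then β else 0) (if (⟨i.val + 1, hi⟩ : Fin n) = j then α else 0)
                = 1 := by
              rw [gateW, if_neg]
              rintro ⟨h, h'⟩
              refine hW ⟨fun hk => hβ ?_, fun hj => hα ?_⟩
              · rwa [if_pos hk] at h
              · rwa [if_pos hj] at h'
            rw [this]
            refine Intertwines.one_of_eq ?_
            ext1 x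
            fin_cases x <;> simp [(a1 _).1, (a0 _).1]
      · rintro q hq
        refine h3 q ?_
        obtain ⟨i', s, e⟩ := q
        rintro (⟨h, h'⟩ | ⟨h, h'⟩) <;> dsimp only at h h' <;> subst h'
        · subst h
          apply hq
          fin_cases e
          exacts [⟨0, rfl⟩, ⟨1, rfl⟩]
        · obtain rfl : i' = ⟨i.val + 1, hi⟩ := Fin.ext h
          apply hq
          fin_cases e
          exacts [⟨2, rfl⟩, ⟨3, rfl⟩]
    · rw [dif_neg hi]
      refine Intertwines.one_of_eq ?_
      ext1 q
      by_cases hq : q.1 = i ∧ q.2.1 = 1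
      · obtain ⟨i', s, e⟩ := q
        obtain ⟨rfl, rfl⟩ := hq
        dsimp only at hi
        rw [h1', h2']
        by_cases hk : i' = k
        · simp only [rotatedLabel, parityWeight, hk, zLabel]
          fin_cases e <;> simp
        · have : ¬ (i' ≤ k) := by
            intro h
            apply hk
            ext
            have := Fin.le_def.1 h
            omega
          simp [rotatedLabel, parityWeight, segmentLabel, hk, this, Prod.ext_iff]
      · refine h3 q ?_
        rintro (h | h)
        · exact hq h
        · omega
  -- The swapping supports miss only Alice's qubits at the first position, which no measurement
  -- touches.
  · rintro ⟨a, s, e⟩ hq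
    simp only [List.mem_finRange, Set.mem_ofPred_eq, forall_const, not_or, not_and] at hq
    obtain rfl : s = 0 := by
      have := (hq a).1 rfl
      omega
    have ha : a.val = 0 := by
      by_contra ha
      exact (hq ⟨a.val - 1, by omega⟩).2 (by simp; omega) rfl
    by_cases hj : a = j
    · simp only [rotatedLabel, parityWeight, hj, zLabel]
      fin_cases e <;> simp
    · have : ¬ j ≤ a := by
        intro h
        apply hj
        ext
        have := Fin.le_def.1 h
        omega
      simp [rotatedLabel, parityWeight, segmentLabel, hj, this, Prod.ext_iff]

theorem msUnitary_parity {j k : Fin n} (hjk : j < k) {α β : Fin 2 → Bit} (hα : α ≠ 0)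
    (hβ : β ≠ 0) {b : MSIndex n → Bit}
    (hA : ∀ i, (fun e => b (i, 0, e)) = if i = j then α else 0)
    (hB : ∀ i, (fun e => b (i, 1, e)) = if i = k then β else 0) {z : MSIndex n → Bit}
    (hz : msUnitary n b z 0 ≠ 0) :
    ∑ q, parityWeight j k α β q * z q = β 0 * β 1 := by
  have h := ((intertwines_entanglementSwapping hα hβ hA hB).mul
    (intertwines_rotations hjk hα hβ hA hB)).mul
    (intertwines_bellPreparation j k (squareLabel α β))
  rw [← Matrix.mul_assoc] at h
  change Intertwines (msUnitary n b) _ _ _ at h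
  rw [intertwines_iff] at h
  -- The initial label has no X part, so it fixes the column `0` with sign 1. The amplitude of `z`
  -- then equals itself times a sign, which must be 1.
  have h' := h z 0
  have h0 : (fun q => (preparationLabel j k (squareLabel α β) q).1) = 0 := by
    ext q; simp only [preparationLabel]; split_ifs <;> rfl
  rw [h0] at h'
  simp only [add_zero, dotProduct_zero, sgn_zero, one_mul, mul_one] at h'
  have h1 : z + (fun _ => 0) = z := add_zero z
  rw [h1, ← mul_assoc, ← sgn_add] at h'
  have h2 : sgn (β 0 * β 1 + (fun q => parityWeight j k α β q) ⬝ᵥ z) = sgn 0 := by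
    rw [sgn_zero]
    exact mul_right_cancel₀ hz (by rw [one_mul]; exact h'.symm)
  have h3 := sgn_injective h2
  exact ((CharTwo.add_eq_zero).1 h3).symm

end Stabilizer

/-! ## Classical strategies -/

/-- Labels of the square are bilinear in `α` and `β`, and the three non-zero vectors of `𝔽₂²` sum to
zero. -/
theorem sum_squareLabel_right (α : Fin 2 → Bit) (e : Fin 2) :
    ∑ β with β ≠ 0, squareLabel α β e = 0 := by
  revert α e; decide

theorem sum_squareLabel_left (β : Fin 2 → Bit) (e : Fin 2) :
    ∑ α with α ≠ 0, squareLabel α β e = 0 := by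
  revert β e; decide

theorem sum_zLabel (e : Fin 2) : ∑ α with α ≠ 0, zLabel α e = 0 := by
  revert e; decide

/-- Bob's qubits at `k` are excluded because their weight does not depend on `β`, and three equal
bits need not cancel. -/
theorem sum_parityWeight_right {n : ℕ} (j k : Fin n) (α : Fin 2 → Bit) {q : MSIndex n}
    (hq : q.2.1 = 0 ∨ q.1 ≠ k) : ∑ β with β ≠ 0, parityWeight j k α β q = 0 := by
  have h1 : ∑ β with β ≠ 0, (squareLabel α β q.2.2).1 = 0 := by
    rw [← Prod.fst_sum, sum_squareLabel_right]; rfl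
  have h2 : ∑ β with β ≠ 0, (squareLabel α β q.2.2).2 = 0 := by
    rw [← Prod.snd_sum, sum_squareLabel_right]; rfl
  have h3 : ∑ β with β ≠ 0, (zLabel β q.2.2).2 = 0 := by
    rw [← Prod.snd_sum, sum_zLabel]; rfl
  unfold parityWeight segmentLabel
  rcases hq with hq | hq <;> split_ifs <;> simp_all

theorem sum_parityWeight_left {n : ℕ} (j k : Fin n) (β : Fin 2 → Bit) {q : MSIndex n}
    (hq : q.2.1 ≠ 0 ∨ q.1 ≠ j) : ∑ α with α ≠ 0, parityWeight j k α β q = 0 := by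
  have h1 : ∑ α with α ≠ 0, (squareLabel α β q.2.2).1 = 0 := by
    rw [← Prod.fst_sum, sum_squareLabel_left]; rfl
  have h2 : ∑ α with α ≠ 0, (squareLabel α β q.2.2).2 = 0 := by
    rw [← Prod.snd_sum, sum_squareLabel_left]; rfl
  have h3 : ∑ α with α ≠ 0, (zLabel α q.2.2).2 = 0 := by
    rw [← Prod.snd_sum, sum_zLabel]; rfl
  unfold parityWeight segmentLabel
  rcases hq with hq | hq <;> split_ifs <;> simp_all

/-- If every output bit is independent of Alice's or of Bob's input, then one of the nine parity
conditions is violated. -/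
theorem exists_parity_ne {n : ℕ} (j k : Fin n)
    (z : (Fin 2 → Bit) → (Fin 2 → Bit) → MSIndex n → Bit)
    (hz : ∀ q, (∀ α β β', z α β q = z α β' q) ∨ ∀ α α' β, z α β q = z α' β q)
    (hj : ∀ e α β β', z α β (j, 0, e) = z α β' (j, 0, e))
    (hk : ∀ e α α' β, z α β (k, 1, e) = z α' β (k, 1, e)) :
    ∃ α β, α ≠ 0 ∧ β ≠ 0 ∧ ∑ q, parityWeight j k α β q * z α β q ≠ β 0 * β 1 := by
  by_contra! hcon
  have h1 : ∑ α : Fin 2 → Bit with α ≠ 0, ∑ β : Fin 2 → Bit with β ≠ 0,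
      ∑ q, parityWeight j k α β q * z α β q = 1 := by
    calc _ = ∑ α : Fin 2 → Bit with α ≠ 0, ∑ β : Fin 2 → Bit with β ≠ 0, β 0 * β 1 :=
          Finset.sum_congr rfl fun α hα => Finset.sum_congr rfl fun β hβ =>
            hcon α β (Finset.mem_filter.1 hα).2 (Finset.mem_filter.1 hβ).2
      _ = 1 := by decide
  have h0 : ∀ q, ∑ α : Fin 2 → Bit with α ≠ 0, ∑ β : Fin 2 → Bit with β ≠ 0,
      parityWeight j k α β q * z α β q = 0 := by
    intro q
    have hA : (q.2.1 = 0 ∨ q.1 ≠ k) → (∀ α β β', z α β q = z α β' q) →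
        ∑ α : Fin 2 → Bit with α ≠ 0, ∑ β : Fin 2 → Bit with β ≠ 0,
          parityWeight j k α β q * z α β q = 0 := by
      intro hq hind
      refine Finset.sum_eq_zero fun α _ => ?_
      simp_rw [hind α _ 0]
      rw [← Finset.sum_mul, sum_parityWeight_right j k α hq, zero_mul]
    have hB : (q.2.1 ≠ 0 ∨ q.1 ≠ j) → (∀ α α' β, z α β q = z α' β q) →
        ∑ α : Fin 2 → Bit with α ≠ 0, ∑ β : Fin 2 → Bit with β ≠ 0,
          parityWeight j k α β q * z α β q = 0 := by
      intro hq hind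
      rw [Finset.sum_comm]
      refine Finset.sum_eq_zero fun β _ => ?_
      simp_rw [hind _ 0 β]
      rw [← Finset.sum_mul, sum_parityWeight_left j k β hq, zero_mul]
    obtain ⟨i, s, e⟩ := q
    by_cases hs : s = 0
    · subst hs
      by_cases h2 : i = j
      · subst h2; exact hA (Or.inl rfl) (hj e)
      · exact (hz _).elim (hA (Or.inl rfl)) (hB (Or.inr h2))
    · obtain rfl : s = 1 := by omega
      by_cases h2 : i = k
      · subst h2; exact hB (Or.inl hs) (hk e)
      · exact (hz _).elim (hA (Or.inr h2)) (hB (Or.inl hs))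
  -- Summing over the output bits last shows that the total parity is both 0 and 1.
  rw [Finset.sum_congr rfl fun α _ => Finset.sum_comm, Finset.sum_comm,
    Finset.sum_eq_zero fun q _ => h0 q] at h1
  exact zero_ne_one h1

/-! ## Propagation of Pauli operators through controlled Clifford circuits -/

section Clifford

variable {Q : Type} [Fintype Q] [DecidableEq Q]

/-- Conjugation by `A` takes Pauli operators to Pauli operators, up to phases. -/
def NormalizesPauli (A : Op Q) : Prop :=
  ∀ p : Label Q, ∃ (p' : Label Q) (c : ℂ), ‖c‖ = 1 ∧ Intertwines A c p p'

theorem IsClifford.normalizesPauli {A : Op Q} (h : IsClifford A) : NormalizesPauli A := by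
  intro p
  obtain ⟨f', h', c, hc, hA⟩ := h.2 (fun q => (p q).1) fun q => (p q).2
  refine ⟨fun q => (f' q, h' q), c, hc, ?_⟩
  have hu : A.conjTranspose * A = 1 := Matrix.mem_unitaryGroup_iff'.1 h.1
  calc A * pauli p = A * pauli p * (A.conjTranspose * A) := by rw [hu, Matrix.mul_one]
    _ = _ := by
      rw [← Matrix.mul_assoc]
      exact (congrArg (· * A) hA).trans (Matrix.smul_mul _ _ _)

theorem NormalizesPauli.one : NormalizesPauli (1 : Op Q) :=
  fun p => ⟨p, 1, norm_one, Intertwines.one p⟩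

theorem NormalizesPauli.mul {A B : Op Q} (hA : NormalizesPauli A) (hB : NormalizesPauli B) :
    NormalizesPauli (A * B) := by
  intro p
  obtain ⟨p', c, hc, h⟩ := hB p
  obtain ⟨p'', d, hd, h'⟩ := hA p'
  exact ⟨p'', d * c, by rw [norm_mul, hc, hd, one_mul], h'.mul h⟩

theorem NormalizesPauli.onWires {ι : Type} [Fintype ι] [DecidableEq ι] {w : ι → Q}
    (hw : Function.Injective w) {G : Op ι} (hG : NormalizesPauli G) :
    NormalizesPauli (onWires w G) := by
  intro p
  obtain ⟨p', c, hc, h⟩ := hG (p ∘ w)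
  refine ⟨Function.extend w p' p, c, hc, Intertwines.onWires hw ?_ fun q hq => ?_⟩
  · rwa [Function.extend_comp hw]
  · exact Function.extend_apply' _ _ _ hq

theorem DepthOneClifford.normalizesPauli (C : DepthOneClifford Q) : NormalizesPauli C.op := by
  unfold DepthOneClifford.op
  generalize C.gates = l
  induction l with
  | nil => exact NormalizesPauli.one
  | cons g l ih =>
    rw [List.map_cons, List.prod_cons]
    exact (g.clifford.normalizesPauli.onWires g.wires.injective).mul ih

/-- If the X parts differed, comparing entries would make the diagonal of `E * E.conjTranspose`
vanish, hence `E = 0`, against the non-zero right-hand side of `hf`. Unitarity of `E` is not needed.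
-/
theorem Intertwines.fst_eq {E : Op Q} {c c' : ℂ} {p p' : Label Q} {f h : Q → Bit} (hc : c ≠ 0)
    (hc' : c' ≠ 0) (hE : Intertwines E c p p')
    (hf : E * pauli p * E.conjTranspose = c' • pauliXZ f h) : f = fun q => (p' q).1 := by
  by_contra hne
  rw [hE, Matrix.smul_mul, Matrix.mul_assoc] at hf
  have hff : ∀ g : Q → Bit, g + g = 0 := fun g => funext fun q => CharTwo.add_self_eq_zero (g q)
  have hd : ∀ y, (E * E.conjTranspose) y y = 0 := by
    intro y
    have h1 := congrFun (congrFun hf (y + fun q => (p' q).1)) y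
    rw [Matrix.smul_apply, Matrix.smul_apply, pauli, pauliXZ_mul_apply, add_assoc, hff, add_zero,
      pauliXZ, if_neg (fun h => hne (add_left_cancel h).symm), smul_zero] at h1
    simpa [hc, sgn_ne_zero] using h1
  have hE0 : E = 0 := by
    ext y x
    have h1 : (∑ x, ‖E y x‖ ^ 2 : ℝ) = 0 := by
      have h2 := hd y
      simp only [Matrix.mul_apply, Matrix.conjTranspose_apply, Complex.star_def,
        Complex.mul_conj'] at h2
      exact_mod_cast h2
    have h3 := (Finset.sum_eq_zero_iff_of_nonneg fun x _ => sq_nonneg ‖E y x‖).1 h1 x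
      (Finset.mem_univ x)
    simpa using h3
  rw [hE0, Matrix.zero_mul, Matrix.mul_zero, smul_zero] at hf
  have h2 := congrFun (congrFun hf f) 0
  simp only [pauliXZ, Matrix.zero_apply, Matrix.smul_apply, zero_add, if_true, dotProduct_zero,
    ZMod.val_zero, pow_zero, smul_eq_mul, mul_one] at h2
  exact hc' h2.symm

end Clifford

/-! ### Locality of Pauli propagation on blocks of qubits. -/

section Blocks

variable {V N M : Type}

/-- Every block of `Φ b p` is determined by at most `v` bits of `b` and at most `t` blocks
of `p`. -/
def BlockLocal (Φ : (V → Bit) → Label (N × M) → Label (N × M)) (v t : ℕ) : Prop :=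
  ∀ q : N, ∃ (Vq : Finset V) (Nq : Finset N), Vq.card ≤ v ∧ Nq.card ≤ t ∧
    ∀ b b' p p', (∀ u ∈ Vq, b u = b' u) → (∀ r, r.1 ∈ Nq → p r = p' r) →
      ∀ i, Φ b p (q, i) = Φ b' p' (q, i)

theorem BlockLocal.comp {Φ Ψ : (V → Bit) → Label (N × M) → Label (N × M)} {v t v' t' : ℕ}
    (hΦ : BlockLocal Φ v t) (hΨ : BlockLocal Ψ v' t') :
    BlockLocal (fun b p => Φ b (Ψ b p)) (v + t * v') (t * t') := by
  classical
  intro q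
  obtain ⟨Vq, Nq, hV, hN, hq⟩ := hΦ q
  choose V' N' hV' hN' hq' using hΨ
  refine ⟨Vq ∪ Nq.biUnion V', Nq.biUnion N', ?_, ?_, ?_⟩
  · refine (Finset.card_union_le _ _).trans (add_le_add hV ?_)
    exact (Finset.card_biUnion_le_card_mul _ _ _ fun r _ => hV' r).trans
      (Nat.mul_le_mul_right _ hN)
  · exact (Finset.card_biUnion_le_card_mul _ _ _ fun r _ => hN' r).trans
      (Nat.mul_le_mul_right _ hN)
  · intro b b' p p' hb hp i
    refine hq b b' _ _ (fun u hu => hb u (Finset.mem_union_left _ hu)) (fun r hr => ?_) i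
    refine hq' r.1 b b' p p' (fun u hu => hb u ?_) (fun s hs => hp s ?_) r.2
    · exact Finset.mem_union_right _ (Finset.mem_biUnion.2 ⟨_, hr, hu⟩)
    · exact Finset.mem_biUnion.2 ⟨_, hr, hs⟩

theorem ElemGate.exists_finset_support [DecidableEq N] (g : ElemGate N) :
    ∃ T : Finset N, T.card ≤ 2 ∧ (T : Set N) = g.support := by
  cases g with
  | h q => exact ⟨{q}, by simp, by simp [ElemGate.support]⟩
  | s q => exact ⟨{q}, by simp, by simp [ElemGate.support]⟩
  | cnot c t hne => exact ⟨{c, t}, Finset.card_le_two, by simp [ElemGate.support]⟩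

variable [Fintype N] [DecidableEq N] [Fintype M] [DecidableEq M]

/-- Conjugation by `A` takes Pauli operators to Pauli operators, up to phases, and acts only on
the blocks in `T`. -/
def ActsOnBlocks (A : Op (N × M)) (T : Set N) : Prop :=
  ∃ τ : Label (N × M) → Label (N × M),
    (∀ p, ∃ c : ℂ, ‖c‖ = 1 ∧ Intertwines A c p (τ p)) ∧
    (∀ p q, q.1 ∉ T → τ p q = p q) ∧
    ∀ p p', (∀ q, q.1 ∈ T → p q = p' q) → ∀ q, q.1 ∈ T → τ p q = τ p' q

theorem NormalizesPauli.actsOnBlocks {G : Op M} (hG : NormalizesPauli G) (n : N) :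
    ActsOnBlocks (MagicSquare.onWires (fun i => (n, i)) G) {n} := by
  choose σ c hc hσ using hG
  refine ⟨fun p q => if q.1 = n then σ (fun i => p (n, i)) q.2 else p q, fun p => ?_, ?_, ?_⟩
  · refine ⟨c fun i => p (n, i), hc _, Intertwines.onWires (Prod.mk_right_injective n) ?_ ?_⟩
    · have := hσ fun i => p (n, i)
      convert this using 1
      · rfl
      · exact funext fun i => if_pos rfl
    · intro q hq
      refine if_neg ?_
      rintro rfl
      exact hq ⟨q.2, rfl⟩
  · intro p q hq
    exact if_neg hq
  · intro p p' h q hq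
    have : (fun i => p (n, i)) = fun i => p' (n, i) := funext fun i => h (n, i) rfl
    simp only [this, if_pos (Set.mem_singleton_iff.1 hq)]

theorem actsOnBlocks_transversal_gateCNOT {m : ℕ} {c t : N} (hne : c ≠ t) :
    ActsOnBlocks ((List.finRange m).map fun i =>
      onWires ![((c, i) : N × Fin m), (t, i)] gateCNOT).prod {c, t} := by
  refine ⟨fun p q => if q.1 = c then ((p (c, q.2)).1, (p (c, q.2)).2 + (p (t, q.2)).2)
    else if q.1 = t then ((p (t, q.2)).1 + (p (c, q.2)).1, (p (t, q.2)).2) else p q,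
    fun p => ⟨1, norm_one, ?_⟩, ?_, ?_⟩
  · have := Intertwines.list_prod (fun i : Fin m => {q : N × Fin m | q.2 = i ∧ (q.1 = c ∨ q.1 = t)})
      (fun i => onWires ![((c, i) : N × Fin m), (t, i)] gateCNOT) (fun _ => 1)
      (l := List.finRange m) (pairwise_disjoint_finRange (by
        rintro i j q ⟨h, _⟩ ⟨h', _⟩; exact h.symm.trans h')) (p := p)
      (p' := fun q => if q.1 = c then ((p (c, q.2)).1, (p (c, q.2)).2 + (p (t, q.2)).2)
        else if q.1 = t then ((p (t, q.2)).1 + (p (c, q.2)).1, (p (t, q.2)).2) else p q) ?_ ?_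
    · simpa using this
    · intro i _ p₁ p₂ h1 h2 h3
      have hc := h1 (c, i) ⟨rfl, Or.inl rfl⟩
      have ht := h1 (t, i) ⟨rfl, Or.inr rfl⟩
      refine intertwines_onWires_gateCNOT (by simpa using hne) ?_ ?_ fun r hr hr' => h3 r ?_
      · rw [h2 _ ⟨rfl, Or.inl rfl⟩, hc, ht]; simp
      · rw [h2 _ ⟨rfl, Or.inr rfl⟩, hc, ht]; simp [hne.symm]
      · rintro ⟨rfl, h | h⟩
        · exact hr (Prod.ext h rfl)
        · exact hr' (Prod.ext h rfl)
    · intro q hq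
      have := hq q.2 (List.mem_finRange _)
      simp only [Set.mem_ofPred_eq, true_and, not_or] at this
      simp [this.1, this.2]
  · intro p q hq
    simp only [Set.mem_insert_iff, Set.mem_singleton_iff, not_or] at hq
    simp [hq.1, hq.2]
  · intro p p' h q _
    have hc := h (c, q.2) (by simp)
    have ht := h (t, q.2) (by simp)
    have hq := h q
    simp only [Set.mem_insert_iff, Set.mem_singleton_iff] at hq
    dsimp only
    rw [hc, ht]
    split_ifs with h1 h2
    · rfl
    · rfl
    · exact hq (by tauto)

theorem LogicalGates.actsOnBlocks_encodedGate {m : ℕ} {Q : CSSCode m}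
    (L : LogicalGates Q) (g : ElemGate N) : ActsOnBlocks (L.encodedGate g) g.support := by
  cases g with
  | h q => exact L.H.normalizesPauli.actsOnBlocks q
  | s q => exact L.S.normalizesPauli.actsOnBlocks q
  | cnot c t hne => exact actsOnBlocks_transversal_gateCNOT hne

-- Supports in a layer are disjoint, so a block is changed by at most one gate: it reads at most two
-- blocks and the control bits of that gate. The clause about untouched blocks drives the induction:
-- on the support of the head gate, the rest of the layer acts trivially.
open Classical in
theorem exists_blockLocal_layer {exec : ElemGate N → Op (N × M)}
    (hexec : ∀ g, ActsOnBlocks (exec g) g.support) {k : ℕ} (l : List (CtrlGate V N))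
    (hl : l.Pairwise fun g g' => Disjoint g.gate.support g'.gate.support)
    (hk : ∀ g ∈ l, g.ctrl.card ≤ k) :
    ∃ Φ : (V → Bit) → Label (N × M) → Label (N × M),
      (∀ b p, ∃ c : ℂ, ‖c‖ = 1 ∧ Intertwines
        (l.map fun g => if g.active (fun v => b v) then exec g.gate else 1).prod c p (Φ b p)) ∧
      (∀ b p q, (∀ g ∈ l, q.1 ∉ g.gate.support) → Φ b p q = p q) ∧ BlockLocal Φ k 2 := by
  induction l with
  | nil =>
    refine ⟨fun _ p => p, fun b p => ⟨1, norm_one, Intertwines.one p⟩, fun _ _ _ _ => rfl,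
      fun q => ⟨∅, {q}, by simp, by simp, ?_⟩⟩
    intro b b' p p' _ hp i
    exact hp (q, i) (by simp)
  | cons g l ih =>
    rw [List.pairwise_cons] at hl
    obtain ⟨Φ, h1, h2, h3⟩ := ih hl.2 fun g' hg' => hk g' (by simp [hg'])
    obtain ⟨τ, t1, t2, t3⟩ := hexec g.gate
    refine ⟨fun b p => if g.active (fun v => b v) then τ (Φ b p) else Φ b p, ?_, ?_, ?_⟩
    · intro b p
      obtain ⟨c, hc, h⟩ := h1 b p
      rw [List.map_cons, List.prod_cons]
      by_cases hg : g.active fun v => b v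
      · obtain ⟨d, hd, h'⟩ := t1 (Φ b p)
        refine ⟨d * c, by rw [norm_mul, hc, hd, one_mul], ?_⟩
        simp only [if_pos hg]
        exact h'.mul h
      · refine ⟨c, hc, ?_⟩
        simp only [if_neg hg, one_mul]
        exact h
    · intro b p q hq
      have hq' := h2 b p q fun g' hg' => hq g' (by simp [hg'])
      dsimp only
      split_ifs
      · rw [t2 _ _ (hq g (by simp)), hq']
      · exact hq'
    · intro q
      by_cases hq : q ∈ g.gate.support
      · obtain ⟨T, hT, hTs⟩ := g.gate.exists_finset_support
        refine ⟨g.ctrl, T, hk g (by simp), hT, ?_⟩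
        intro b b' p p' hb hp i
        have hactive : (fun v : g.ctrl => b v) = fun v : g.ctrl => b' v :=
          funext fun v => hb v v.2
        have hsame : ∀ r : N × M, r.1 ∈ g.gate.support → Φ b p r = Φ b' p' r := by
          intro r hr
          have hoff : ∀ g' ∈ l, r.1 ∉ g'.gate.support := fun g' hg' =>
            Set.disjoint_left.1 (hl.1 g' hg') hr
          rw [h2 b p r hoff, h2 b' p' r hoff]
          exact hp r (by rw [← Finset.mem_coe, hTs]; exact hr)
        simp only [hactive]
        split_ifs
        · exact t3 _ _ hsame _ hq
        · exact hsame _ hq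
      · obtain ⟨Vq, Nq, hV, hN, h⟩ := h3 q
        refine ⟨Vq, Nq, hV, hN, fun b b' p p' hb hp i => ?_⟩
        have hτ : ∀ b p, (if g.active (fun v => b v) then τ (Φ b p) else Φ b p) (q, i) =
            Φ b p (q, i) := by
          intro b p
          split_ifs
          · exact t2 _ _ hq
          · rfl
        dsimp only
        rw [hτ, hτ]
        exact h b b' p p' hb hp i

/-- Each further layer doubles the number of blocks and turns `v` control bits into `k + 2v`, which
gives `k(2^D - 1)`. -/
theorem CtrlCircuit.exists_blockLocal_run {exec : ElemGate N → Op (N × M)}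
    (hexec : ∀ g, ActsOnBlocks (exec g) g.support) {k : ℕ} (U : CtrlCircuit V N)
    (hk : U.ControlledByAtMost k) :
    ∃ Φ : (V → Bit) → Label (N × M) → Label (N × M),
      (∀ b p, ∃ c : ℂ, ‖c‖ = 1 ∧ Intertwines (U.run exec b) c p (Φ b p)) ∧
      BlockLocal Φ (k * (2 ^ U.depth - 1)) (2 ^ U.depth) := by
  classical
  obtain ⟨layers, hdisj⟩ := U
  unfold CtrlCircuit.run CtrlCircuit.ControlledByAtMost CtrlCircuit.depth at *
  dsimp only at *
  induction layers using List.reverseRecOn with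
  | nil =>
    refine ⟨fun _ p => p, fun b p => ⟨1, norm_one, Intertwines.one p⟩,
      fun q => ⟨∅, {q}, by simp, by simp, ?_⟩⟩
    intro b b' p p' _ hp i
    exact hp (q, i) (by simp)
  | append_singleton ls l ih =>
    obtain ⟨Ψ, p1, p2⟩ := ih (fun l' hl' => hdisj l' (by simp [hl']))
      (fun l' hl' => hk l' (by simp [hl']))
    obtain ⟨Φ, h1, -, h3⟩ := exists_blockLocal_layer hexec l (hdisj l (by simp)) (hk l (by simp))
    refine ⟨fun b p => Φ b (Ψ b p), fun b p => ?_, ?_⟩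
    · obtain ⟨c, hc, h⟩ := p1 b p
      obtain ⟨d, hd, h'⟩ := h1 b (Ψ b p)
      refine ⟨d * c, by rw [norm_mul, hc, hd, one_mul], ?_⟩
      rw [List.foldl_append]
      exact h'.mul h
    · convert h3.comp p2 using 1
      · rw [List.length_append, List.length_singleton, pow_succ]
        have : 1 ≤ 2 ^ ls.length := Nat.one_le_two_pow
        zify [this, (by omega : 1 ≤ 2 ^ ls.length * 2)]
        ring
      · rw [List.length_append, List.length_singleton, pow_succ, mul_comm]

end Blocks

/-! ## Light cones of classical circuits -/

namespace ClassicalCircuit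

variable {I O : Type} (C : ClassicalCircuit I O)

theorem gateDepth_lt_of_source {g : Fin C.size} {i : Fin (C.fanIn g)} {g' : Fin g.val}
    (h : C.source g i = .inr g') :
    C.gateDepth ⟨g'.val, g'.isLt.trans g.isLt⟩ + 1 ≤ C.gateDepth g := by
  conv_rhs => rw [gateDepth, add_comm]
  refine add_le_add (le_trans ?_ (Finset.le_sup (Finset.mem_univ i))) le_rfl
  rw [h]

theorem exists_lightcone_gateValue {K : ℕ} (hK : C.FanInAtMost K) (g : Fin C.size) :
    ∃ T : Finset I, T.card ≤ K ^ C.gateDepth g ∧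
      ∀ x x' : I → Bit, (∀ i ∈ T, x i = x' i) → C.gateValue x g = C.gateValue x' g := by
  classical
  induction hg : g.val using Nat.strong_induction_on generalizing g with
  | _ a ih =>
    subst hg
    have hK1 : 1 ≤ K := (C.fanIn_pos g).trans_le (hK g)
    have hd : 1 ≤ C.gateDepth g := by rw [gateDepth]; exact Nat.le_add_right _ _
    have hsrc : ∀ i : Fin (C.fanIn g), ∃ T : Finset I, T.card ≤ K ^ (C.gateDepth g - 1) ∧
        ∀ x x' : I → Bit, (∀ i ∈ T, x i = x' i) →
          (∀ v, C.source g i = .inl v → x v = x' v) ∧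
          ∀ g', C.source g i = .inr g' →
            C.gateValue x ⟨g'.val, g'.isLt.trans g.isLt⟩ =
              C.gateValue x' ⟨g'.val, g'.isLt.trans g.isLt⟩ := by
      intro i
      rcases hs : C.source g i with v | g'
      · refine ⟨{v}, by simpa using Nat.one_le_pow _ _ hK1, fun x x' h => ⟨?_, by simp⟩⟩
        rintro _ ⟨⟩
        exact h v (by simp)
      · obtain ⟨T, hT, h⟩ := ih g'.val g'.isLt ⟨g'.val, g'.isLt.trans g.isLt⟩ rfl
        refine ⟨T, hT.trans (Nat.pow_le_pow_right hK1 ?_), fun x x' hx => ⟨by simp, ?_⟩⟩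
        · have := C.gateDepth_lt_of_source hs
          omega
        · rintro _ ⟨⟩
          exact h x x' hx
    choose T hT h using hsrc
    refine ⟨Finset.univ.biUnion T, ?_, fun x x' hx => ?_⟩
    · refine (Finset.card_biUnion_le_card_mul _ _ _ fun i _ => hT i).trans ?_
      rw [Finset.card_univ, Fintype.card_fin]
      calc C.fanIn g * K ^ (C.gateDepth g - 1) ≤ K * K ^ (C.gateDepth g - 1) :=
            Nat.mul_le_mul_right _ (hK g)
        _ = K ^ C.gateDepth g := by rw [← pow_succ', Nat.sub_add_cancel hd]
    · rw [gateValue, gateValue]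
      congr 1
      ext1 i
      have := h i x x' fun v hv => hx v (Finset.mem_biUnion.2 ⟨i, Finset.mem_univ _, hv⟩)
      revert this
      rcases C.source g i with v | g'
      · exact fun h => h.1 v rfl
      · exact fun h => h.2 g' rfl

theorem gateDepth_le_depth [Fintype O] {o : O} {g : Fin C.size} (h : C.output o = .inr g) :
    C.gateDepth g ≤ C.depth := by
  refine le_trans ?_ (Finset.le_sup (Finset.mem_univ o))
  rw [h]

theorem exists_lightcone_eval [Fintype O] {K : ℕ} (hK : C.FanInAtMost K) (o : O) :
    -- With `max K 1` the powers are monotone in the exponent even for `K = 0`.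
    ∃ T : Finset I, T.card ≤ (max K 1) ^ C.depth ∧
      ∀ x x' : I → Bit, (∀ i ∈ T, x i = x' i) → C.eval x o = C.eval x' o := by
  unfold eval
  rcases ho : C.output o with v | g
  · exact ⟨{v}, by simpa using Nat.one_le_pow _ _ (le_max_right K 1), fun x x' h => h v (by simp)⟩
  · obtain ⟨T, hT, h⟩ := C.exists_lightcone_gateValue hK g
    refine ⟨T, hT.trans ?_, h⟩
    exact (Nat.pow_le_pow_left (le_max_left K 1) _).trans
      (Nat.pow_le_pow_right (le_max_right K 1) (C.gateDepth_le_depth ho))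

/-- The output bits depend on few input bits, for every choice of the random bits. -/
theorem exists_lightcone_eval_random [Fintype O] {V : Type} {r : ℕ}
    (C : ClassicalCircuit (V ⊕ Fin r) O) {K : ℕ} (hK : C.FanInAtMost K) (o : O) :
    ∃ T : Finset V, T.card ≤ (max K 1) ^ C.depth ∧
      ∀ (b b' : V → Bit) (ρ : Fin r → Bit), (∀ v ∈ T, b v = b' v) →
        C.eval (Sum.elim b ρ) o = C.eval (Sum.elim b' ρ) o := by
  obtain ⟨T, hT, h⟩ := C.exists_lightcone_eval hK o
  refine ⟨T.toLeft, T.card_toLeft_le.trans hT, fun b b' ρ hb => h _ _ ?_⟩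
  rintro (v | i) hv
  · exact hb v (Finset.mem_toLeft.2 hv)
  · rfl

end ClassicalCircuit

/-- The bits decoded from the output of a classical circuit solve the bare relation whenever the
output solves the noise-tolerant relation, and each of them depends on few input bits. -/
theorem exists_local_decoding {V N : Type} [Fintype N] [DecidableEq N] {m mAnc K r k : ℕ}
    {Q : CSSCode m} (L : LogicalGates Q)
    (Rec : (Fin mAnc → Bit) → (Fin m → Bit) × (Fin m → Bit)) (Dec : (Fin m → Bit) → Bit)
    (U : CtrlCircuit V N) (hU : U.ControlledByAtMost k)
    (C : ClassicalCircuit (V ⊕ Fin r) (N × Fin mAnc ⊕ N × Fin m)) (hC : C.FanInAtMost K) :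
    ∃ z : (V → Bit) → (Fin r → Bit) → N → Bit,
      (∀ b ρ, noiseTolerantRelation L Rec Dec U b
        (fun q i => C.eval (Sum.elim b ρ) (Sum.inl (q, i)))
        (fun q i => C.eval (Sum.elim b ρ) (Sum.inr (q, i))) → bareRelation U.op b (z b ρ)) ∧
      ∀ q, ∃ T : Finset V,
        T.card ≤ k * 2 ^ U.depth + (2 ^ U.depth * mAnc + m) * (max K 1) ^ C.depth ∧
        ∀ b b' ρ, (∀ v ∈ T, b v = b' v) → z b ρ q = z b' ρ q := by
  classical
  obtain ⟨Φ, hΦ, hloc⟩ := U.exists_blockLocal_run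
    L.actsOnBlocks_encodedGate hU
  choose T hT h using fun o => C.exists_lightcone_eval_random hC o
  let p : (V → Bit) → (Fin r → Bit) → Label (N × Fin m) := fun b ρ x =>
    ((Rec fun i => C.eval (Sum.elim b ρ) (Sum.inl (x.1, i))).1 x.2,
      (Rec fun i => C.eval (Sum.elim b ρ) (Sum.inl (x.1, i))).2 x.2)
  refine ⟨fun b ρ q => Dec fun i =>
    C.eval (Sum.elim b ρ) (Sum.inr (q, i)) + (Φ b (p b ρ) (q, i)).1, ?_, fun q => ?_⟩
  · rintro b ρ ⟨f, h, c, hc, hE, hbare⟩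
    obtain ⟨d, hd, hI⟩ := hΦ b (p b ρ)
    -- The correction `f` in the relation is forced to be the X part of the propagated recovery
    -- operator.
    have := hI.fst_eq (norm_ne_zero_iff.1 (by rw [hd]; exact one_ne_zero))
      (norm_ne_zero_iff.1 (by rw [hc]; exact one_ne_zero)) hE
    subst this
    exact hbare
  · obtain ⟨Vq, Nq, hV, hN, hq⟩ := hloc q
    -- Three sources: the control bits, the light cones of `s` on the blocks that reach `q`, and the
    -- light cones of `y` on the block `q`.
    refine ⟨Vq ∪ ((Nq.biUnion fun q' => Finset.univ.biUnion fun i => T (Sum.inl (q', i))) ∪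
      Finset.univ.biUnion fun i => T (Sum.inr (q, i))), ?_, fun b b' ρ hb => ?_⟩
    · refine (Finset.card_union_le _ _).trans (add_le_add (hV.trans ?_) ?_)
      · exact Nat.mul_le_mul_left _ (Nat.sub_le _ _)
      · refine (Finset.card_union_le _ _).trans ?_
        rw [add_mul, mul_assoc]
        refine add_le_add ?_ ?_
        · refine (Finset.card_biUnion_le_card_mul _ _ _ fun q' _ =>
            (Finset.card_biUnion_le_card_mul _ _ _ fun i _ => hT _)).trans ?_
          rw [Finset.card_univ, Fintype.card_fin]
          exact Nat.mul_le_mul_right _ hN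
        · refine (Finset.card_biUnion_le_card_mul _ _ _ fun i _ => hT _).trans ?_
          rw [Finset.card_univ, Fintype.card_fin]
    · have hp : ∀ r : N × Fin m, r.1 ∈ Nq → p b ρ r = p b' ρ r := by
        intro x hx
        have : (fun i => C.eval (Sum.elim b ρ) (Sum.inl (x.1, i))) =
            fun i => C.eval (Sum.elim b' ρ) (Sum.inl (x.1, i)) := by
          ext1 i
          refine h _ b b' ρ fun v hv => hb v ?_
          simp only [Finset.mem_union, Finset.mem_biUnion, Finset.mem_univ, true_and]
          exact Or.inr (Or.inl ⟨x.1, hx, i, hv⟩)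
        simp only [p, this]
      have hy : ∀ i, C.eval (Sum.elim b ρ) (Sum.inr (q, i)) =
          C.eval (Sum.elim b' ρ) (Sum.inr (q, i)) := by
        intro i
        refine h _ b b' ρ fun v hv => hb v ?_
        simp only [Finset.mem_union, Finset.mem_biUnion, Finset.mem_univ, true_and]
        exact Or.inr (Or.inr ⟨i, hv⟩)
      have hV := fun i => hq b b' (p b ρ) (p b' ρ)
        (fun u hu => hb u (Finset.mem_union_left _ hu)) hp i
      simp only [hy, hV]

/-! ## Random inputs -/

/-- The input with `α` at Alice's position `j`, `β` at Bob's position `k`, and `00` elsewhere. -/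
def pairInput {n : ℕ} (j k : Fin n) (α β : Fin 2 → Bit) : MSIndex n → Bit := fun q =>
  if q.2.1 = 0 then if q.1 = j then α q.2.2 else 0 else if q.1 = k then β q.2.2 else 0

theorem pairInput_alice {n : ℕ} (j k : Fin n) (α β : Fin 2 → Bit) (i : Fin n) :
    (fun e => pairInput j k α β (i, 0, e)) = if i = j then α else 0 := by
  by_cases h : i = j <;> simp [pairInput, h, funext_iff]

theorem pairInput_bob {n : ℕ} (j k : Fin n) (α β : Fin 2 → Bit) (i : Fin n) :
    (fun e => pairInput j k α β (i, 1, e)) = if i = k then β else 0 := by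
  by_cases h : i = k <;> simp [pairInput, h, funext_iff]

/-- The pairs of positions with `j < k`. -/
def orderedPairs (n : ℕ) : Finset (Fin n × Fin n) := {p | p.1 < p.2}

/-- The pairs of non-zero inputs. -/
def nonzeroPairs : Finset ((Fin 2 → Bit) × (Fin 2 → Bit)) := {a | a.1 ≠ 0 ∧ a.2 ≠ 0}

theorem card_nonzeroPairs : nonzeroPairs.card = 9 := by decide

theorem two_mul_card_orderedPairs (n : ℕ) : 2 * (orderedPairs n).card = n * (n - 1) := by
  have h : (orderedPairs n).card = ∑ i ∈ Finset.range n, i := by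
    rw [orderedPairs, Finset.card_filter, Fintype.sum_prod_type_right, ← Fin.sum_univ_eq_sum_range]
    refine Finset.sum_congr rfl fun k _ => ?_
    dsimp only
    rw [← Finset.card_filter, ← Fin.card_Iio k]
    congr 1
    ext j; simp
  rw [h, mul_comm, Finset.sum_range_id_mul_two]

/-- Since `α` and `β` are non-zero, their positions can be read off the input, so each input in `S`
has unique parameters. -/
theorem sum_msInputs {n : ℕ} {M : Type} [AddCommMonoid M] (F : (MSIndex n → Bit) → M) :
    ∑ b ∈ msInputs n, F b =
      ∑ p ∈ orderedPairs n, ∑ a ∈ nonzeroPairs, F (pairInput p.1 p.2 a.1 a.2) := by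
  classical
  rw [← Finset.sum_product']
  symm
  refine Finset.sum_bij (fun t _ => pairInput t.1.1 t.1.2 t.2.1 t.2.2) ?_ ?_ ?_ ?_
  · rintro ⟨⟨j, k⟩, α, β⟩ h
    simp only [Finset.mem_product, orderedPairs, nonzeroPairs, Finset.mem_filter,
      Finset.mem_univ, true_and] at h
    simp only [msInputs, Finset.mem_filter, Finset.mem_univ, true_and]
    exact ⟨j, k, α, β, h.1, h.2.1, h.2.2, pairInput_alice j k α β, pairInput_bob j k α β⟩
  · rintro ⟨⟨j, k⟩, α, β⟩ h ⟨⟨j', k'⟩, α', β'⟩ h' heq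
    simp only [Finset.mem_product, orderedPairs, nonzeroPairs, Finset.mem_filter,
      Finset.mem_univ, true_and] at h h'
    dsimp only at heq
    have hA : (if j = j' then α' else 0) = α := by
      rw [← pairInput_alice j' k' α' β' j, ← heq, pairInput_alice, if_pos rfl]
    have hB : (if k = k' then β' else 0) = β := by
      rw [← pairInput_bob j' k' α' β' k, ← heq, pairInput_bob, if_pos rfl]
    split_ifs at hA hB with h1 h2
    · subst h1 h2 hA hB; rfl
    · exact absurd hB.symm h.2.2
    · exact absurd hA.symm h.2.1
    · exact absurd hA.symm h.2.1
  · intro b hb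
    simp only [msInputs, Finset.mem_filter, Finset.mem_univ, true_and] at hb
    obtain ⟨j, k, α, β, hjk, hα, hβ, hA, hB⟩ := hb
    refine ⟨((j, k), (α, β)), ?_, ?_⟩
    · simp [orderedPairs, nonzeroPairs, hjk, hα, hβ]
    · ext ⟨i, s, e⟩
      fin_cases s
      · exact (congrFun (pairInput_alice j k α β i) e).trans (congrFun (hA i) e).symm
      · exact (congrFun (pairInput_bob j k α β i) e).trans (congrFun (hB i) e).symm
  · intros; rfl

theorem card_msInputs (n : ℕ) : (msInputs n).card = 9 * (orderedPairs n).card := by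
  rw [Finset.card_eq_sum_ones, sum_msInputs]
  simp [card_nonzeroPairs, mul_comm]

theorem PMF.sum_toReal {α : Type} [Fintype α] (μ : PMF α) : ∑ x, (μ x).toReal = 1 := by
  rw [← ENNReal.toReal_sum fun x _ => μ.apply_ne_top x, ← tsum_fintype (L := .unconditional _),
    μ.tsum_coe, ENNReal.toReal_one]

/-- If one of the nine inputs fails for all but a tenth of the pairs of positions, then the
success probability is at most `9/10`. -/
theorem successProbability_le {n r : ℕ} {O : Type} (C : ClassicalCircuit (MSIndex n ⊕ Fin r) O)
    (μ : PMF (Fin r → Bit)) (R : (MSIndex n → Bit) → (O → Bit) → Prop)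
    (bad : Finset (Fin n × Fin n)) (hbad : 10 * bad.card ≤ (orderedPairs n).card)
    (hgood : ∀ p ∈ orderedPairs n, p ∉ bad → ∀ ρ, ∃ a ∈ nonzeroPairs,
      ¬ R (pairInput p.1 p.2 a.1 a.2) (C.eval (Sum.elim (pairInput p.1 p.2 a.1 a.2) ρ))) :
    successProbability C μ (msInputs n) R ≤ 9 / 10 := by
  classical
  unfold successProbability
  refine div_le_of_le_mul₀ (Nat.cast_nonneg _) (by norm_num) ?_
  -- The random bits are fixed first: a pair outside `bad` loses one of nine inputs, and a pair in
  -- `bad` may win all nine.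
  have hpair : ∀ ρ, ∀ p ∈ orderedPairs n,
      (∑ a ∈ nonzeroPairs, if R (pairInput p.1 p.2 a.1 a.2)
        (C.eval (Sum.elim (pairInput p.1 p.2 a.1 a.2) ρ)) then (1 : ℝ) else 0) ≤
        8 + if p ∈ bad then 1 else 0 := by
    intro ρ p hp
    rw [← Finset.sum_filter, Finset.sum_const, nsmul_eq_mul, mul_one]
    by_cases hpb : p ∈ bad
    · rw [if_pos hpb]
      have := Finset.card_filter_le nonzeroPairs fun a => R (pairInput p.1 p.2 a.1 a.2)
        (C.eval (Sum.elim (pairInput p.1 p.2 a.1 a.2) ρ))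
      rw [card_nonzeroPairs] at this
      have : ((Finset.card _ : ℕ) : ℝ) ≤ (9 : ℕ) := Nat.cast_le.2 this
      refine this.trans (by norm_num)
    · rw [if_neg hpb]
      obtain ⟨a, ha, hRa⟩ := hgood p hp hpb ρ
      have : (Finset.filter (fun a => R (pairInput p.1 p.2 a.1 a.2)
        (C.eval (Sum.elim (pairInput p.1 p.2 a.1 a.2) ρ))) nonzeroPairs).card <
          nonzeroPairs.card :=
        Finset.card_lt_card (Finset.filter_ssubset.2 ⟨a, ha, hRa⟩)
      rw [card_nonzeroPairs] at this
      have : ((Finset.card _ : ℕ) : ℝ) ≤ (8 : ℕ) := Nat.cast_le.2 (Nat.lt_succ_iff.1 this)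
      refine this.trans (by norm_num)
  -- With `P` ordered pairs, `8P + P/10` is exactly nine tenths of the `9P` inputs.
  have htotal : ∀ ρ, (∑ b ∈ msInputs n, if R b (C.eval (Sum.elim b ρ)) then (1 : ℝ) else 0) ≤
      9 / 10 * (msInputs n).card := by
    intro ρ
    rw [sum_msInputs, card_msInputs]
    refine (Finset.sum_le_sum (hpair ρ)).trans ?_
    rw [Finset.sum_add_distrib, ← Finset.sum_filter, Finset.sum_const, Finset.sum_const]
    have h1 : (Finset.filter (· ∈ bad) (orderedPairs n)).card ≤ bad.card :=
      Finset.card_le_card fun p hp => (Finset.mem_filter.1 hp).2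
    have h2 : (10 : ℝ) * (Finset.filter (· ∈ bad) (orderedPairs n)).card ≤
        (orderedPairs n).card := by
      exact_mod_cast (Nat.mul_le_mul_left 10 h1).trans hbad
    simp only [nsmul_eq_mul, mul_one]
    push_cast
    linarith
  rw [Finset.sum_comm]
  calc _ = ∑ ρ, (μ ρ).toReal *
        ∑ b ∈ msInputs n, if R b (C.eval (Sum.elim b ρ)) then (1 : ℝ) else 0 := by
        refine Finset.sum_congr rfl fun ρ _ => ?_
        rw [Finset.mul_sum]
        exact Finset.sum_congr rfl fun b _ => by rw [mul_ite, mul_one, mul_zero]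
    _ ≤ ∑ ρ, (μ ρ).toReal * (9 / 10 * (msInputs n).card) :=
        Finset.sum_le_sum fun ρ _ => mul_le_mul_of_nonneg_left (htotal ρ) ENNReal.toReal_nonneg
    _ = _ := by rw [← Finset.sum_mul, PMF.sum_toReal, one_mul]

/-- Pairs of positions which both influence the same output bit. -/
def correlatedPairs {n : ℕ} (T : MSIndex n → Finset (MSIndex n)) : Finset (Fin n × Fin n) :=
  Finset.univ.biUnion fun q =>
    ((insert q (T q)).image Prod.fst) ×ˢ ((insert q (T q)).image Prod.fst)

theorem card_correlatedPairs_le {n : ℕ} (T : MSIndex n → Finset (MSIndex n)) {s : ℕ}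
    (hT : ∀ q, (T q).card ≤ s) : (correlatedPairs T).card ≤ 4 * n * (s + 1) ^ 2 := by
  refine (Finset.card_biUnion_le_card_mul _ _ ((s + 1) ^ 2) fun q _ => ?_).trans ?_
  · rw [Finset.card_product, sq]
    have : ((insert q (T q)).image Prod.fst).card ≤ s + 1 :=
      Finset.card_image_le.trans ((Finset.card_insert_le _ _).trans (Nat.succ_le_succ (hT q)))
    exact Nat.mul_le_mul this this
  · simp only [Finset.card_univ, Fintype.card_prod, Fintype.card_fin]
    apply le_of_eq
    ring

/-- Local output bits cannot solve the bare relation for more than eight of the nine inputs at an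
uncorrelated pair of positions. -/
theorem exists_not_bareRelation {n : ℕ} {U : CtrlCircuit (MSIndex n) (MSIndex n)}
    (hU : RealizesMagicSquareCircuit U) (z : (MSIndex n → Bit) → MSIndex n → Bit)
    (T : MSIndex n → Finset (MSIndex n))
    (hz : ∀ q b b', (∀ v ∈ T q, b v = b' v) → z b q = z b' q) {p : Fin n × Fin n}
    (hp : p ∈ orderedPairs n) (hpT : p ∉ correlatedPairs T) :
    ∃ a ∈ nonzeroPairs, ¬ bareRelation U.op (pairInput p.1 p.2 a.1 a.2)
      (z (pairInput p.1 p.2 a.1 a.2)) := by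
  obtain ⟨j, k⟩ := p
  have hjk : j < k := (Finset.mem_filter.1 hp).2
  simp only [correlatedPairs, Finset.mem_biUnion, Finset.mem_univ, true_and, Finset.mem_product,
    Finset.mem_image, not_exists, not_and] at hpT
  have hA : ∀ q, (∀ v ∈ T q, v.1 ≠ j) → ∀ α α' β,
      z (pairInput j k α β) q = z (pairInput j k α' β) q := by
    intro q hq α α' β
    refine hz q _ _ fun v hv => ?_
    simp [pairInput, hq v hv]
  have hB : ∀ q, (∀ v ∈ T q, v.1 ≠ k) → ∀ α β β',
      z (pairInput j k α β) q = z (pairInput j k α β') q := by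
    intro q hq α β β'
    refine hz q _ _ fun v hv => ?_
    simp [pairInput, hq v hv]
  obtain ⟨α, β, hα, hβ, hne⟩ : ∃ α β, α ≠ 0 ∧ β ≠ 0 ∧ ∑ q, parityWeight j k α β q *
      z (pairInput j k α β) q ≠ β 0 * β 1 := by
    refine exists_parity_ne j k (fun α β => z (pairInput j k α β)) ?_ ?_ ?_
    · intro q
      by_cases hq : ∃ v ∈ T q, v.1 = j
      · obtain ⟨v, hv, hvj⟩ := hq
        exact Or.inl (hB q fun w hw hwk =>
          hpT q ⟨v, Finset.mem_insert_of_mem hv, hvj⟩ w (Finset.mem_insert_of_mem hw) hwk)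
      · exact Or.inr (hA q fun v hv hvj => hq ⟨v, hv, hvj⟩)
    -- Here `insert q` in `correlatedPairs` matters: an end bit counts its own position as seen, so
    -- it cannot depend on the far input.
    · intro e
      exact hB _ fun w hw hwk =>
        hpT (j, 0, e) ⟨_, Finset.mem_insert_self _ _, rfl⟩ w (Finset.mem_insert_of_mem hw) hwk
    · intro e
      exact hA _ fun w hw hwj =>
        hpT (k, 1, e) ⟨w, Finset.mem_insert_of_mem hw, hwj⟩ _ (Finset.mem_insert_self _ _) rfl
  refine ⟨(α, β), by simp [nonzeroPairs, hα, hβ], fun hR => hne ?_⟩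
  refine msUnitary_parity hjk hα hβ (pairInput_alice j k α β) (pairInput_bob j k α β) ?_
  obtain ⟨c, -, hUc⟩ := hU (pairInput j k α β)
  unfold bareRelation at hR
  rw [hUc] at hR
  intro h0
  simp [h0] at hR

/-! ## Asymptotics -/

-- With `x = log n`, once `x ≥ A` the sizes are at most `x^(a+1)`, and `d < δ x / log x` makes the
-- fan-in power at most `exp(x/8) = n^(1/8)`. The remaining factor is polylogarithmic, also at most
-- `n^(1/8)`, so the squared bound is at most `n^(1/2)`, and `80 n^(1/2) + 1 ≤ n` once `n^(1/2) ≥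
-- 81`.
open Filter Topology in
theorem exists_lightcone_bound (A : ℝ) (a D k : ℕ) :
    ∃ δ : ℝ, 0 < δ ∧ ∃ n₀ : ℕ, ∀ n : ℕ, n₀ ≤ n → ∀ m mAnc K D' d : ℕ,
      (m : ℝ) ≤ A * Real.log n ^ a → (mAnc : ℝ) ≤ A * Real.log n ^ a →
      (K : ℝ) ≤ A * Real.log n ^ a → D' ≤ D →
      (d : ℝ) < δ * (Real.log n / Real.log (Real.log n)) →
      80 * (k * 2 ^ D' + (2 ^ D' * mAnc + m) * max K 1 ^ d + 1) ^ 2 + 1 ≤ n := by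
  -- Collects the coefficients of the three summands: `k * 2 ^ D`, then `2 ^ D + 1`, then `1`.
  set c : ℝ := k * 2 ^ D + 2 ^ D + 2 with hc
  have hlog : Tendsto (fun n : ℕ => Real.log n) atTop atTop :=
    Real.tendsto_log_atTop.comp tendsto_natCast_atTop_atTop
  have hpow : ∀ᶠ x : ℝ in atTop, c * x ^ (a + 1) ≤ Real.exp (x / 8) := by
    have h1 : Tendsto (fun x : ℝ => Real.exp (x / 8) / (x / 8) ^ (a + 1)) atTop atTop :=
      (Real.tendsto_exp_div_pow_atTop (a + 1)).comp
        (tendsto_id.atTop_div_const (by norm_num : (0 : ℝ) < 8))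
    filter_upwards [h1.eventually_ge_atTop (c * 8 ^ (a + 1)), eventually_gt_atTop 0] with x hx hx0
    rw [le_div_iff₀ (by positivity), div_pow, mul_assoc, mul_div_cancel₀ _ (by positivity)] at hx
    exact hx
  have hexp : ∀ᶠ x : ℝ in atTop, 81 ≤ Real.exp (x / 2) :=
    (Real.tendsto_exp_atTop.comp
      (tendsto_id.atTop_div_const (by norm_num : (0 : ℝ) < 2))).eventually_ge_atTop 81
  have hev : ∀ᶠ x : ℝ in atTop, c * x ^ (a + 1) ≤ Real.exp (x / 8) ∧ 81 ≤ Real.exp (x / 2) ∧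
      A ≤ x ∧ 1 < x :=
    hpow.and (hexp.and ((eventually_ge_atTop A).and (eventually_gt_atTop 1)))
  obtain ⟨n₀, hn₀⟩ := eventually_atTop.1 (hlog.eventually hev)
  refine ⟨1 / (8 * (a + 1)), by positivity, n₀, ?_⟩
  intro n hn m mAnc K D' d hm hmAnc hK hD hd
  obtain ⟨h1, h2, hA, hx1⟩ := hn₀ n hn
  set x := Real.log n with hx
  have hx0 : 0 < x := one_pos.trans hx1
  have hn0 : (0 : ℝ) < n := by
    rcases Nat.eq_zero_or_pos n with rfl | h
    · simp at hx; linarith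
    · exact_mod_cast h
  have hXle : A * x ^ a ≤ x ^ (a + 1) := by
    rw [pow_succ']
    exact mul_le_mul_of_nonneg_right hA (by positivity)
  have hX1 : 1 ≤ x ^ (a + 1) := one_le_pow₀ hx1.le
  have hKX : ((max K 1 : ℕ) : ℝ) ≤ x ^ (a + 1) := by
    rw [Nat.cast_max, Nat.cast_one]
    exact max_le (hK.trans hXle) hX1
  have hKd : ((max K 1 : ℕ) : ℝ) ^ d ≤ Real.exp (x / 8) := by
    have hlx : 0 < Real.log x := Real.log_pos hx1
    have h3 : d * ((a + 1) * Real.log x) ≤ x / 8 := by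
      rw [← mul_div_assoc, lt_div_iff₀ hlx, div_mul_eq_mul_div, one_mul,
        lt_div_iff₀ (by positivity)] at hd
      linarith
    calc ((max K 1 : ℕ) : ℝ) ^ d ≤ (x ^ (a + 1)) ^ d := by gcongr
      _ = Real.exp (d * ((a + 1) * Real.log x)) := by
        rw [Real.exp_nat_mul, ← Nat.cast_succ, Real.exp_nat_mul, Real.exp_log hx0]
      _ ≤ Real.exp (x / 8) := Real.exp_le_exp.2 h3
  have hD2 : (2 : ℝ) ^ D' ≤ 2 ^ D := pow_le_pow_right₀ one_le_two hD
  have hL : ((k * 2 ^ D' + (2 ^ D' * mAnc + m) * max K 1 ^ d + 1 : ℕ) : ℝ) ≤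
      Real.exp (x / 4) := by
    have he1 : 1 ≤ Real.exp (x / 8) := Real.one_le_exp (by positivity)
    have hXe : 1 ≤ x ^ (a + 1) * Real.exp (x / 8) := one_le_mul_of_one_le_of_one_le hX1 he1
    calc ((k * 2 ^ D' + (2 ^ D' * mAnc + m) * max K 1 ^ d + 1 : ℕ) : ℝ)
        = k * 2 ^ D' + (2 ^ D' * mAnc + m) * ((max K 1 : ℕ) : ℝ) ^ d + 1 := by push_cast; ring
      _ ≤ k * 2 ^ D + (2 ^ D * x ^ (a + 1) + x ^ (a + 1)) * Real.exp (x / 8) + 1 := by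
        gcongr
        · exact hmAnc.trans hXle
        · exact hm.trans hXle
      _ ≤ c * x ^ (a + 1) * Real.exp (x / 8) := by
        have : (0 : ℝ) ≤ k * 2 ^ D := by positivity
        rw [hc]
        nlinarith
      _ ≤ Real.exp (x / 8) * Real.exp (x / 8) :=
        mul_le_mul_of_nonneg_right h1 (Real.exp_pos _).le
      _ = Real.exp (x / 4) := by rw [← Real.exp_add]; congr 1; ring
  have hfinal : (80 : ℝ) * ((k * 2 ^ D' + (2 ^ D' * mAnc + m) * max K 1 ^ d + 1 : ℕ) : ℝ) ^ 2 + 1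
      ≤ n := by
    calc _ ≤ 80 * Real.exp (x / 4) ^ 2 + 1 := by gcongr
      _ = 80 * Real.exp (x / 2) + 1 := by
        rw [← Real.exp_nat_mul]; congr 3; push_cast; ring
      _ ≤ Real.exp (x / 2) * Real.exp (x / 2) := by nlinarith
      _ = n := by rw [← Real.exp_add, add_halves, hx, Real.exp_log hn0]
  exact_mod_cast hfinal

end MagicSquare

/-! ### The depth lower bound. -/

theorem mainTheorem4 (A : ℝ) (a D k : ℕ) :
    ∃ δ : ℝ, 0 < δ ∧ ∃ n₀ : ℕ, ∀ n : ℕ, n₀ ≤ n →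
      ∀ (m mAnc K r : ℕ) (Q : CSSCode m) (L : LogicalGates Q)
        (Rec : (Fin mAnc → Bit) → (Fin m → Bit) × (Fin m → Bit))
        (Dec : (Fin m → Bit) → Bit)
        (U : CtrlCircuit (MSIndex n) (MSIndex n))
        (C : ClassicalCircuit (MSIndex n ⊕ Fin r) (MSIndex n × Fin mAnc ⊕ MSIndex n × Fin m))
        (μ : PMF (Fin r → Bit)),
        (m : ℝ) ≤ A * Real.log n ^ a →
        (mAnc : ℝ) ≤ A * Real.log n ^ a →
        (K : ℝ) ≤ A * Real.log n ^ a →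
        U.depth ≤ D → U.ControlledByAtMost k → RealizesMagicSquareCircuit U →
        C.FanInAtMost K →
        9 / 10 < successProbability C μ (msInputs n)
          (fun b o => noiseTolerantRelation L Rec Dec U b
            (fun q i => o (Sum.inl (q, i))) (fun q i => o (Sum.inr (q, i)))) →
        δ * (Real.log n / Real.log (Real.log n)) ≤ (C.depth : ℝ) := by
  obtain ⟨δ, hδ, n₀, hn₀⟩ := exists_lightcone_bound A a D k
  refine ⟨δ, hδ, n₀, ?_⟩
  intro n hn m mAnc K r Q L Rec Dec U C μ hm hmAnc hK hD hk hU hC hsucc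
  by_contra! hd
  have hbound := hn₀ n hn m mAnc K U.depth C.depth hm hmAnc hK hD hd
  obtain ⟨z, hz, hloc⟩ := exists_local_decoding L Rec Dec U hk C hC
  choose T hT hzT using hloc
  refine absurd hsucc (not_lt.2 (successProbability_le C μ _ (correlatedPairs T) ?_ ?_))
  -- Ten times `4n(s+1)²` must not exceed `n(n-1)/2`, that is `80(s+1)² ≤ n - 1`; this is where the
  -- constant 80 comes from.
  · have h1 := card_correlatedPairs_le T hT
    have h2 := two_mul_card_orderedPairs n
    have h3 := Nat.mul_le_mul_left n (Nat.le_sub_one_of_lt hbound)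
    nlinarith
  · intro p hp hpT ρ
    obtain ⟨a, ha, hne⟩ := exists_not_bareRelation hU (fun b => z b ρ) T
      (fun q b b' h => hzT q b b' ρ h) hp hpT
    exact ⟨a, ha, fun hR => hne (hz _ ρ hR)⟩
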